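/- A *comparator circuit* on variables $x_1,\dots,x_n$ consists of finitely many wires, each labelled by a literal ($x_i$ or $\neg x_i$), a finite sequence of gates, each an ordered pair $(w,w')$ of distinct wires, and a designated output wire. On an input $a\in\{0,1\}^n$ every wire starts with the value of its literal; the gates are applied in order, the gate $(w,w')$ replacing the values of $w$ and $w'$ by the conjunction and the disjunction, respectively, of their current values; the circuit outputs the final value $C(a)$ of the output wire. All logarithms are to base $2$. **Theorem.** There are constants $c,d\ge 1$ and $\gamma>0$ and functions $f_k:\{0,1\}^*\to\{0,1\}$, $k\in\mathbb N$, such that the following holds. 1. The functions $f_k$ are polynomial-time computable, uniformly in $k$: there is one algorithm that, given $k$ in binary and $x\in\{0,1\}^*$, computes $f_k(x)$ in time polynomial in $|x|+\log (k+2)$. 2. For all integers $n\ge 2$ and $k\ge c\log n$, every comparator circuit $C$ on $n$ variables that has at most $$\frac{n^{1.5}}{d\cdot k\cdot\sqrt{\log n}}$$ wires, or has at most that many gates, satisfies $$\Pr_{x\in\{0,1\}^n}\left[f_k(x)=C(x)\right]\le \frac12+\frac1{2^{\gamma k}} .$$ 3. Taking $k=O(\log n)$ gives a worst-case lower bound: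 for every $K$ there is a $\delta>0$ such that for all integers $n\ge 2$ and $k$ with $c\log n\le k\le K\log n$, every comparator circuit on $n$ variables that computes $f_k$ on $\{0,1\}^n$ has at least $\delta\,(n/\log n)^{1.5}$ wires and at least $\delta\,(n/\log n)^{1.5}$ gates. -/

import Mathlib

/-- A comparator circuit on `n` input variables: finitely many wires, each labelled by a literal
(`(i, true)` is the variable `x_i`, `(i, false)` its negation), a sequence of gates, each an ordered
pair of two different wires, and a designated output wire. -/
structure ComparatorCircuit (n : ℕ) where
  /-- the number of wires -/
  numWires : ℕ
  /-- the literal at the start of each wire -/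
  label : Fin numWires → Fin n × Bool
  /-- the gates, in the order in which they are applied -/
  gates : List (Fin numWires × Fin numWires)
  /-- each gate connects two different wires -/
  gates_ne : ∀ g ∈ gates, g.1 ≠ g.2
  /-- the output wire -/
  output : Fin numWires

namespace ComparatorCircuit

/-- The size of the circuit: its number of gates. -/
def numGates {n : ℕ} (C : ComparatorCircuit n) : ℕ := C.gates.length

/-- The values of the wires before any gate is applied. -/
def initial {n : ℕ} (C : ComparatorCircuit n) (x : Fin n → Bool) : Fin C.numWires → Bool :=
  fun w => if (C.label w).2 then x (C.label w).1 else !(x (C.label w).1)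

/-- One gate: the first wire receives the conjunction of the two wires, the second one receives
their disjunction, the other wires keep their values. -/
def applyGate {m : ℕ} (v : Fin m → Bool) (g : Fin m × Fin m) : Fin m → Bool :=
  Function.update (Function.update v g.1 (v g.1 && v g.2)) g.2 (v g.1 || v g.2)

/-- The Boolean value computed by the circuit on the input `x`. -/
def eval {n : ℕ} (C : ComparatorCircuit n) (x : Fin n → Bool) : Bool :=
  (C.gates.foldl applyGate (C.initial x)) C.output

/-- The fraction of the inputs in `{0,1}^n` on which the circuit agrees with `h`. -/
noncomputable def agreement {n : ℕ} (C : ComparatorCircuit n) (h : (Fin n → Bool) → Bool) : ℝ :=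
  ((Finset.univ.filter fun x : Fin n → Bool => h x = C.eval x).card : ℝ) / 2 ^ n

end ComparatorCircuit

/-- The family `f 0, f 1, f 2, …` of Boolean functions on bit strings is uniformly polynomial-time
computable: one Turing machine, given `k` in binary and a string `x`, outputs the bit `f k x` in
time polynomial in the length of this input. -/
def UniformlyPolyTime (f : ℕ → List Bool → Bool) : Prop :=
  Nonempty (Turing.TM2ComputableInPolyTime
    (Computability.encodingProd Computability.encodingNatBool
      (Computability.encodingList Bool)).encode
    Computability.encodeBool
    (fun p : ℕ × List Bool => f p.1 p.2))

/-- The restriction of a function on bit strings to the strings of length `n`. -/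
def onLength (h : List Bool → Bool) (n : ℕ) : (Fin n → Bool) → Bool :=
  fun x => h (List.ofFn x)

/-! The hard function cuts its input into groups of five bits. The first bits of the groups form a
message `y` of `n / 5` bits. The other four bits of a group are a selector symbol, and these symbols
are added up over consecutive blocks of length `e`, the power of two with `k < e ≤ 2 * k`. The
output is the bit of an encoding of `y` at the position given by this sum. Since the position is a
sum over blocks, any single block still controls it completely when the rest of the input is fixed.

By pigeonhole, a small circuit has a block whose variables label at most `ℓ` relevant wires, with
`ℓ` of order size times `k / n`. With all other variables fixed, the circuit is a comparator network
on the lattice of Boolean functions of the block, and all but `ℓ` of its wires start constant. A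
gate with comparable inputs merely permutes them. A gate with incomparable inputs lowers the number
of incomparable pairs (`incomparablePairs_comparator_lt`). Hence at most `ℓ ^ 2` gates matter
(`exists_short_network`), and only about `ℓ ^ O(ℓ ^ 2)` functions can arise. This set of functions
is the same for all messages, because message bits lie outside the block. The size bound gives `ℓ ^
2 * log n ≤ n / 128`, so the set is tiny compared with the `2 ^ (n / 5)` messages.

The code is of Reed–Solomon type concatenated with a Hadamard code: the polynomial with coefficients
`y` is evaluated at one of `2 ^ e` points of a field of degree `e` over `𝔽₅`, and a parity of binary
digits of the value is taken. Distinct messages agree at no more than `n / 5` points, so codewords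
are almost orthogonal, and by the Johnson bound every function correlates with few of them
(`card_correlated_le`). Thus for all but few messages the agreement is at most `(1 + ε) / 2` with `ε
= 2 ^ (-e / 8)`. Averaging over all shifts of the message and of the block turns this into a bound
over all inputs (`card_eq_code_le`).

If `n < 32 * e`, the function is the parity instead. The size bound then leaves a variable unread,
and the agreement is exactly one half. The worst-case bound follows because a circuit computing the
function has agreement `1`.

For uniform computability the field is explicit: it is generated by `ζ` with `ζ ^ e = 2`, so
arithmetic reduces to cyclic shifts of coefficient lists, which a stack machine performs in cubic
time. -/

/-! ### Comparator networks over a lattice -/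

section ComparatorNetwork

variable {ι α : Type*} [DecidableEq ι] [Lattice α]

/-- The comparator `p` applied to a family `v` of elements of a lattice. -/
def comparator (v : ι → α) (p : ι × ι) : ι → α :=
  Function.update (Function.update v p.1 (v p.1 ⊓ v p.2)) p.2 (v p.1 ⊔ v p.2)

theorem comparator_apply_of_ne (v : ι → α) {p : ι × ι} {i : ι} (h₁ : i ≠ p.1) (h₂ : i ≠ p.2) :
    comparator v p i = v i := by
  simp [comparator, h₁, h₂]

theorem comparator_fst (v : ι → α) {p : ι × ι} (h : p.1 ≠ p.2) :
    comparator v p p.1 = v p.1 ⊓ v p.2 := by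
  simp [comparator, h]

theorem comparator_snd (v : ι → α) (p : ι × ι) : comparator v p p.2 = v p.1 ⊔ v p.2 := by
  simp [comparator]

theorem comparator_self (v : ι → α) (i : ι) : comparator v (i, i) = v := by
  simp [comparator]

/-- Lets a permutation created by an earlier gate be moved past later gates, at the price of
relabelling them. -/
theorem comparator_comp_perm (v : ι → α) (π : Equiv.Perm ι) (p : ι × ι) :
    comparator (v ∘ π) p = comparator v (π p.1, π p.2) ∘ π := by
  funext i
  by_cases h₂ : i = p.2
  · subst h₂; simp [comparator]
  · by_cases h₁ : i = p.1
    · subst h₁; simp [comparator, h₂]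
    · simp [comparator, h₁, h₂]

theorem comparator_of_le (v : ι → α) {p : ι × ι} (h : v p.1 ≤ v p.2) : comparator v p = v := by
  simp [comparator, inf_eq_left.2 h, sup_eq_right.2 h]

theorem comparator_of_ge (v : ι → α) {p : ι × ι} (h : v p.2 ≤ v p.1) :
    comparator v p = v ∘ Equiv.swap p.1 p.2 := by
  funext i
  by_cases h₂ : i = p.2
  · subst h₂; simp [comparator, sup_eq_left.2 h]
  · by_cases h₁ : i = p.1
    · subst h₁; simp [comparator, h₂, inf_eq_right.2 h]
    · simp [comparator, h₁, h₂, Equiv.swap_apply_of_ne_of_ne h₁ h₂]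

theorem foldl_comparator_eqOn {R : Set ι} {v w : ι → α} (hvw : Set.EqOn v w R)
    (l : List (ι × ι)) (hl : ∀ p ∈ l, p.1 ∈ R ∧ p.2 ∈ R) :
    Set.EqOn (l.foldl comparator v) (l.foldl comparator w) R := by
  induction l generalizing v w with
  | nil => exact hvw
  | cons p l ih =>
    refine ih (fun i hi => ?_) (fun q hq => hl q (List.mem_cons_of_mem _ hq))
    obtain ⟨h₁, h₂⟩ := hl p List.mem_cons_self
    simp only [comparator, Function.update_apply, hvw h₁, hvw h₂, hvw hi]

theorem foldl_comparator_apply_of_notMem {R : Set ι} (v : ι → α) (l : List (ι × ι))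
    (hl : ∀ p ∈ l, p.1 ∈ R ∧ p.2 ∈ R) {i : ι} (hi : i ∉ R) :
    l.foldl comparator v i = v i := by
  induction l generalizing v with
  | nil => rfl
  | cons p l ih =>
    obtain ⟨h₁, h₂⟩ := hl p List.mem_cons_self
    rw [List.foldl_cons, ih _ (fun q hq => hl q (List.mem_cons_of_mem _ hq)),
      comparator_apply_of_ne _ (ne_of_mem_of_not_mem h₁ hi).symm
        (ne_of_mem_of_not_mem h₂ hi).symm]

/-- Lattice operations on functions are pointwise. A circuit on a whole family of inputs can
therefore be run once, on wires carrying functions of the parameter. -/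
theorem foldl_comparator_pi {β : Type*} [Lattice β] {X : Type*} (v : ι → X → β)
    (l : List (ι × ι)) (i : ι) (x : X) :
    l.foldl comparator v i x = l.foldl comparator (fun j => v j x) i := by
  induction l generalizing v with
  | nil => rfl
  | cons p l ih =>
    rw [List.foldl_cons, List.foldl_cons, ih]
    have hp : (fun j => comparator v p j x) = comparator (fun j => v j x) p := ?_
    · rw [hp]
    funext j
    by_cases h₂ : j = p.2
    · subst h₂; simp [comparator]
    · by_cases h₁ : j = p.1
      · subst h₁; simp [comparator, h₂]
      · simp [comparator, h₁, h₂]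

open Classical in
/-- `1` if the two elements are incomparable, `0` otherwise. -/
noncomputable def incomparable (a b : α) : ℕ := if a ≤ b ∨ b ≤ a then 0 else 1

theorem incomparable_comm (a b : α) : incomparable a b = incomparable b a := by
  unfold incomparable
  by_cases h : a ≤ b <;> by_cases h' : b ≤ a <;> simp [h, h']

theorem incomparable_self (a : α) : incomparable a a = 0 := by simp [incomparable]

theorem incomparable_le_one (a b : α) : incomparable a b ≤ 1 := by
  unfold incomparable; split_ifs <;> simp

/-- An element comparable with `b` or with `c` is comparable with the meet or the join, and one
comparable with both is comparable with both of these. So a gate creates no incomparability with a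
third wire on balance. -/
theorem incomparable_inf_sup_le (a b c : α) :
    incomparable a (b ⊓ c) + incomparable a (b ⊔ c) ≤ incomparable a b + incomparable a c := by
  have h₁ : a ≤ b → a ≤ b ⊔ c := fun h => le_sup_of_le_left h
  have h₂ : a ≤ c → a ≤ b ⊔ c := fun h => le_sup_of_le_right h
  have h₃ : b ≤ a → b ⊓ c ≤ a := fun h => inf_le_of_left_le h
  have h₄ : c ≤ a → b ⊓ c ≤ a := fun h => inf_le_of_right_le h
  have h₅ : a ≤ b → a ≤ c → a ≤ b ⊓ c := le_inf
  have h₆ : b ≤ a → c ≤ a → b ⊔ c ≤ a := sup_le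
  unfold incomparable
  by_cases hab : a ≤ b <;> by_cases hba : b ≤ a <;> by_cases hac : a ≤ c <;>
    by_cases hca : c ≤ a <;> simp_all <;> split_ifs <;> simp

/-- The number of ordered pairs of incomparable members of a family. -/
noncomputable def incomparablePairs [Fintype ι] (v : ι → α) : ℕ :=
  ∑ i, ∑ j, incomparable (v i) (v j)

theorem incomparablePairs_eq [Fintype ι] (v : ι → α) {a b : ι} (hab : a ≠ b) :
    incomparablePairs v =
      ∑ i ∈ {a, b}ᶜ, ∑ j ∈ {a, b}ᶜ, incomparable (v i) (v j) +
      2 * ∑ i ∈ {a, b}ᶜ, (incomparable (v i) (v a) + incomparable (v i) (v b)) +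
      2 * incomparable (v a) (v b) := by
  have key : ∀ f : ι → ℕ, ∑ i, f i = ∑ i ∈ {a, b}ᶜ, f i + (f a + f b) := fun f => by
    rw [← Finset.sum_compl_add_sum {a, b} f, Finset.sum_pair hab]
  have hrow : ∀ i, ∑ j, incomparable (v i) (v j) =
      ∑ j ∈ {a, b}ᶜ, incomparable (v i) (v j) +
        (incomparable (v i) (v a) + incomparable (v i) (v b)) := fun i => key _
  have hcol : ∀ c, ∑ j ∈ {a, b}ᶜ, incomparable (v c) (v j) =
      ∑ j ∈ {a, b}ᶜ, incomparable (v j) (v c) := fun c =>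
    Finset.sum_congr rfl fun j _ => incomparable_comm _ _
  unfold incomparablePairs
  rw [key, hrow a, hrow b, Finset.sum_congr rfl fun i _ => hrow i, Finset.sum_add_distrib, hcol a,
    hcol b, Finset.sum_add_distrib, incomparable_self, incomparable_self,
    incomparable_comm (v b) (v a)]
  ring

/-- The potential that bounds the number of essential gates: the meet lies below the join, so the
pair `p` itself becomes comparable, while by `incomparable_inf_sup_le` the pairs with other wires do
not get worse. -/
theorem incomparablePairs_comparator_lt [Fintype ι] (v : ι → α) {p : ι × ι}
    (h₁ : ¬ v p.1 ≤ v p.2) (h₂ : ¬ v p.2 ≤ v p.1) :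
    incomparablePairs (comparator v p) + 1 ≤ incomparablePairs v := by
  have hne : p.1 ≠ p.2 := fun h => h₁ (by rw [h])
  rw [incomparablePairs_eq v hne, incomparablePairs_eq _ hne, comparator_fst v hne,
    comparator_snd]
  have hout : ∀ i ∈ ({p.1, p.2}ᶜ : Finset ι), comparator v p i = v i := fun i hi => by
    simp only [Finset.mem_compl, Finset.mem_insert, Finset.mem_singleton, not_or] at hi
    exact comparator_apply_of_ne v hi.1 hi.2
  have e₁ : ∑ i ∈ {p.1, p.2}ᶜ, ∑ j ∈ {p.1, p.2}ᶜ,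
        incomparable (comparator v p i) (comparator v p j) =
      ∑ i ∈ {p.1, p.2}ᶜ, ∑ j ∈ {p.1, p.2}ᶜ, incomparable (v i) (v j) :=
    Finset.sum_congr rfl fun i hi => Finset.sum_congr rfl fun j hj => by
      rw [hout i hi, hout j hj]
  have e₂ : ∑ i ∈ {p.1, p.2}ᶜ, (incomparable (comparator v p i) (v p.1 ⊓ v p.2) +
        incomparable (comparator v p i) (v p.1 ⊔ v p.2)) ≤
      ∑ i ∈ {p.1, p.2}ᶜ, (incomparable (v i) (v p.1) + incomparable (v i) (v p.2)) :=
    Finset.sum_le_sum fun i hi => by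
      rw [hout i hi]; exact incomparable_inf_sup_le _ _ _
  have e₃ : incomparable (v p.1 ⊓ v p.2) (v p.1 ⊔ v p.2) = 0 := by
    simp [incomparable, inf_le_left.trans (le_sup_left (a := v p.1) (b := v p.2))]
  have e₄ : incomparable (v p.1) (v p.2) = 1 := by simp [incomparable, h₁, h₂]
  omega

/-- If all members of the family outside `N` are comparable with everything, then, up to a
permutation of the positions, a comparator network acts like one of at most
`incomparablePairs v` comparators inside `N`. -/
theorem exists_short_network [Fintype ι] (v : ι → α) (N : Set ι)
    (hN : ∀ i ∉ N, ∀ a, v i ≤ a ∨ a ≤ v i) (l : List (ι × ι)) :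
    ∃ (l' : List (ι × ι)) (π : Equiv.Perm ι),
      l.foldl comparator v = l'.foldl comparator v ∘ π ∧ (∀ p ∈ l', p.1 ∈ N ∧ p.2 ∈ N) ∧
        l'.length + incomparablePairs (l'.foldl comparator v) ≤ incomparablePairs v := by
  induction l using List.reverseRecOn with
  | nil => exact ⟨[], 1, rfl, by simp, by simp⟩
  | append_singleton l p ih =>
    obtain ⟨l', π, h, hl', hlen⟩ := ih
    rw [List.foldl_append, List.foldl_cons, List.foldl_nil, h, comparator_comp_perm]
    set w := l'.foldl comparator v with hw
    by_cases h₁ : w (π p.1) ≤ w (π p.2)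
    · exact ⟨l', π, by rw [← hw, comparator_of_le _ h₁], hl', hlen⟩
    by_cases h₂ : w (π p.2) ≤ w (π p.1)
    -- Comparable inputs in the wrong order are exchanged, which the permutation absorbs.
    · refine ⟨l', π.trans (Equiv.swap (π p.1) (π p.2)), ?_, hl', hlen⟩
      rw [← hw, comparator_of_ge _ h₂]; rfl
    -- Wires outside `N` are untouched by `l'` and so remain comparable with everything. A gate with
    -- incomparable inputs must therefore lie inside `N`.
    have hmem : ∀ i, ¬ (∀ a, w i ≤ a ∨ a ≤ w i) → i ∈ N := fun i hi => by
      by_contra hiN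
      exact hi (by rw [hw, foldl_comparator_apply_of_notMem v l' hl' hiN]; exact hN i hiN)
    refine ⟨l' ++ [(π p.1, π p.2)], π, ?_, ?_, ?_⟩
    · rw [List.foldl_append, List.foldl_cons, List.foldl_nil]
    · intro q hq
      rcases List.mem_append.1 hq with hq | hq
      · exact hl' q hq
      · rw [List.mem_singleton.1 hq]
        exact ⟨hmem _ fun H => (H (w (π p.2))).elim h₁ h₂,
          hmem _ fun H => (H (w (π p.1))).elim h₂ h₁⟩
    · have := incomparablePairs_comparator_lt w (p := (π p.1, π p.2)) h₁ h₂
      rw [List.foldl_append, List.foldl_cons, List.foldl_nil, List.length_append,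
        List.length_singleton, ← hw]
      omega

theorem incomparablePairs_le [Fintype ι] (v : ι → α) (N : Finset ι)
    (hN : ∀ i ∉ N, ∀ a, v i ≤ a ∨ a ≤ v i) : incomparablePairs v ≤ N.card ^ 2 := by
  have hz : ∀ i ∉ N, ∀ a, incomparable (v i) a = 0 := fun i hi a => by
    simp [incomparable, hN i hi a]
  calc incomparablePairs v
      = ∑ i ∈ N, ∑ j ∈ N, incomparable (v i) (v j) := by
        unfold incomparablePairs
        rw [← Finset.sum_subset (Finset.subset_univ N)
          fun i _ hi => Finset.sum_eq_zero fun j _ => hz i hi _]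
        refine Finset.sum_congr rfl fun i _ => ?_
        rw [← Finset.sum_subset (Finset.subset_univ N)
          fun j _ hj => by rw [incomparable_comm]; exact hz j hj _]
    _ ≤ ∑ i ∈ N, ∑ j ∈ N, 1 :=
        Finset.sum_le_sum fun i _ => Finset.sum_le_sum fun j _ => incomparable_le_one _ _
    _ = N.card ^ 2 := by simp [sq]

end ComparatorNetwork

/-! ### Functions computed by networks with few non-constant wires -/

section Counting

variable {ι Z : Type*} [DecidableEq ι] [Fintype Z]

/-- The functions computed by the comparator networks whose wires in `N` start with `φ`: a
sequence of `N.card ^ 2` comparators inside `N` and an output, which is a wire in `N` or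
a constant. -/
noncomputable def networkFunctions (N : Finset ι) (φ : ι → Z → Bool) : Finset (Z → Bool) :=
  (Finset.univ : Finset ((Fin (N.card ^ 2) → N × N) × (N ⊕ Bool))).image fun c =>
    Sum.elim
      (fun i : N => (List.ofFn fun s => ((c.1 s).1.1, (c.1 s).2.1)).foldl comparator φ i.1)
      (fun b _ => b) c.2

theorem card_networkFunctions_le (N : Finset ι) (φ : ι → Z → Bool) :
    (networkFunctions N φ).card ≤ (N.card ^ 2) ^ (N.card ^ 2) * (N.card + 2) := by
  refine Finset.card_image_le.trans (le_of_eq ?_)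
  simp [sq]

theorem foldl_comparator_append_replicate {α : Type*} [Lattice α] (v : ι → α)
    (l : List (ι × ι)) (i : ι) (r : ℕ) :
    (l ++ List.replicate r (i, i)).foldl comparator v = l.foldl comparator v := by
  rw [List.foldl_append]
  induction r with
  | zero => rfl
  | succ r ih => rw [List.replicate_succ, List.foldl_cons, comparator_self, ih]

/-- Constant functions are the bottom and top of the function lattice, hence comparable with
everything, and `exists_short_network` applies. The resulting permutation only changes which wire is
read as output. -/
theorem foldl_comparator_mem_networkFunctions [Fintype ι] (N : Finset ι) (φ v : ι → Z → Bool)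
    (hφ : ∀ i ∈ N, v i = φ i) (hv : ∀ i ∉ N, ∃ b : Bool, v i = fun _ => b)
    (l : List (ι × ι)) (o : ι) : l.foldl comparator v o ∈ networkFunctions N φ := by
  have hN : ∀ i ∉ N, ∀ a, v i ≤ a ∨ a ≤ v i := fun i hi a => by
    obtain ⟨b, hb⟩ := hv i hi
    cases b
    · exact Or.inl fun z => by rw [hb]; exact bot_le
    · exact Or.inr fun z => by rw [hb]; exact le_top
  obtain ⟨l', π, h, hl', hlen⟩ := exists_short_network v (N : Set ι) (by simpa using hN) l
  rw [h, Function.comp_apply]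
  simp only [networkFunctions, Finset.mem_image, Finset.mem_univ, true_and]
  have hlen' : l'.length ≤ N.card ^ 2 := by
    have := incomparablePairs_le v N hN
    omega
  -- A wire `i₀` in `N` is needed to pad the list to length `N.card ^ 2` with idle comparators `(i₀,
  -- i₀)`. Without one there are no comparators at all and the output is constant.
  rcases N.eq_empty_or_nonempty with rfl | ⟨i₀, hi₀⟩
  · obtain ⟨b, hb⟩ := hv (π o) (by simp)
    refine ⟨⟨fun s => (Fin.cast (by simp) s : Fin 0).elim0, Sum.inr b⟩, ?_⟩
    have : l' = [] := by simpa using hlen'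
    subst this
    simp [hb]
  · set r := N.card ^ 2 - l'.length
    set l'' := l' ++ List.replicate r (i₀, i₀) with hl''
    have hlen'' : l''.length = N.card ^ 2 := by simp [hl'', r]; omega
    have hmem : ∀ p ∈ l'', p.1 ∈ N ∧ p.2 ∈ N := fun p hp => by
      rcases List.mem_append.1 hp with hp | hp
      · exact hl' p hp
      · rw [List.eq_of_mem_replicate hp]; exact ⟨hi₀, hi₀⟩
    have hfold : l''.foldl comparator v = l'.foldl comparator v :=
      foldl_comparator_append_replicate v l' i₀ r
    let c : Fin (N.card ^ 2) → N × N := fun s =>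
      let p := l''.get (Fin.cast hlen''.symm s)
      have hp := hmem p (List.get_mem _ _)
      (⟨p.1, hp.1⟩, ⟨p.2, hp.2⟩)
    have hc : (List.ofFn fun s => ((c s).1.1, (c s).2.1)) = l'' := by
      apply List.ext_get (by simp [hlen''])
      intro s h₁ h₂
      simp [c]
    by_cases ho : π o ∈ N
    · refine ⟨⟨c, Sum.inl ⟨π o, ho⟩⟩, ?_⟩
      simp only [Sum.elim_inl, hc]
      rw [← hfold]
      exact (foldl_comparator_eqOn (R := (N : Set ι)) (fun i hi => hφ i (by simpa using hi)) l''
        (by simpa using hmem) (by simpa using ho)).symm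
    · obtain ⟨b, hb⟩ := hv (π o) ho
      refine ⟨⟨c, Sum.inr b⟩, ?_⟩
      rw [foldl_comparator_apply_of_notMem v l' hl' (by simpa using ho), hb]
      rfl

end Counting

/-! ### Comparator circuits -/

namespace ComparatorCircuit

variable {n : ℕ} (C : ComparatorCircuit n)

theorem eval_eq_foldl_comparator (x : Fin n → Bool) :
    C.eval x = C.gates.foldl comparator (C.initial x) C.output := rfl

/-- The wires which are the output or touched by a gate. -/
def touchedWires : Finset (Fin C.numWires) :=
  insert C.output ((C.gates.map Prod.fst).toFinset ∪ (C.gates.map Prod.snd).toFinset)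

theorem output_mem_touchedWires : C.output ∈ C.touchedWires := by simp [touchedWires]

theorem gates_mem_touchedWires : ∀ p ∈ C.gates, p.1 ∈ C.touchedWires ∧ p.2 ∈ C.touchedWires := by
  rintro ⟨a, b⟩ hp
  simp only [touchedWires, Finset.mem_insert, Finset.mem_union, List.mem_toFinset, List.mem_map]
  exact ⟨Or.inr (Or.inl ⟨_, hp, rfl⟩), Or.inr (Or.inr ⟨_, hp, rfl⟩)⟩

theorem card_touchedWires_le_numWires : C.touchedWires.card ≤ C.numWires := by
  simpa using C.touchedWires.card_le_univ

/-- Counting touched wires treats both size measures at once. The summand `1` is the output wire,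
which no gate need touch. -/
theorem card_touchedWires_le_numGates : C.touchedWires.card ≤ 2 * C.numGates + 1 := by
  refine (Finset.card_insert_le _ _).trans (Nat.add_le_add_right ?_ 1)
  refine (Finset.card_union_le _ _).trans ?_
  have h₁ := (C.gates.map Prod.fst).toFinset_card_le
  have h₂ := (C.gates.map Prod.snd).toFinset_card_le
  simp only [List.length_map] at h₁ h₂
  unfold numGates
  omega

/-- The value of the circuit depends only on the variables which label touched wires. -/
theorem eval_congr {x y : Fin n → Bool}
    (h : ∀ w ∈ C.touchedWires, x (C.label w).1 = y (C.label w).1) : C.eval x = C.eval y := by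
  rw [eval_eq_foldl_comparator, eval_eq_foldl_comparator]
  refine foldl_comparator_eqOn (R := (C.touchedWires : Set _)) (fun w hw => ?_) _
    (by simpa using C.gates_mem_touchedWires) (by simpa using C.output_mem_touchedWires)
  simp only [initial, h w (by simpa using hw)]

/-- A family of inputs that is constant outside a set `T` of variables: as a function of the
parameter, the circuit is a network whose non-constant wires are the touched wires with a label
in `T`. -/
theorem eval_mem_networkFunctions {Z : Type*} [Fintype Z]
    (T : Finset (Fin n)) (x φ : Z → Fin n → Bool) (hφ : ∀ z, ∀ i ∈ T, x z i = φ z i)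
    (hx : ∀ i ∉ T, ∃ b, ∀ z, x z i = b) :
    (fun z => C.eval (x z)) ∈
      networkFunctions (C.touchedWires.filter fun w => (C.label w).1 ∈ T)
        (fun w z => C.initial (φ z) w) := by
  -- Untouched wires do not influence the output. Setting them to `false` makes them constant, so
  -- they do not count towards `N`.
  have : (fun z => C.eval (x z)) = C.gates.foldl comparator
      (fun w z => if w ∈ C.touchedWires then C.initial (x z) w else false) C.output := by
    funext z
    rw [foldl_comparator_pi, eval_eq_foldl_comparator]
    refine foldl_comparator_eqOn (R := (C.touchedWires : Set _)) (fun w hw => ?_) _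
      (by simpa using C.gates_mem_touchedWires) (by simpa using C.output_mem_touchedWires)
    simp [Finset.mem_coe.1 hw]
  rw [this]
  refine foldl_comparator_mem_networkFunctions _ _ _ (fun w hw => ?_) (fun w hw => ?_) _ _
  · rw [Finset.mem_filter] at hw
    funext z
    simp only [hw.1, if_true, initial, hφ z _ hw.2]
  · by_cases hwR : w ∈ C.touchedWires
    · obtain ⟨b, hb⟩ := hx (C.label w).1 fun h => hw (Finset.mem_filter.2 ⟨hwR, h⟩)
      exact ⟨if (C.label w).2 then b else !b, by funext z; simp only [hwR, if_true, initial, hb]⟩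
    · exact ⟨false, by simp [hwR]⟩

end ComparatorCircuit

/-! ### Correlation of Boolean functions and list decoding -/

/-- The sign `±1` of a Boolean value. -/
def boolSign (b : Bool) : ℝ := if b then -1 else 1

theorem boolSign_mul_self (b : Bool) : boolSign b * boolSign b = 1 := by cases b <;> simp [boolSign]

theorem boolSign_mul (a b : Bool) : boolSign a * boolSign b = if a = b then 1 else -1 := by
  cases a <;> cases b <;> simp [boolSign]

section ListDecoding

variable {Y Z : Type*} [Fintype Z]

/-- The correlation sum of two Boolean functions. -/
noncomputable def corrSum (g h : Z → Bool) : ℝ := ∑ z, boolSign (g z) * boolSign (h z)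

theorem corrSum_self (g : Z → Bool) : corrSum g g = Fintype.card Z := by
  simp [corrSum, boolSign_mul_self]

theorem card_agree_eq (g h : Z → Bool) :
    ((Finset.univ.filter fun z => g z = h z).card : ℝ) = (Fintype.card Z + corrSum g h) / 2 := by
  have hs : corrSum g h = ∑ z, (2 * (if g z = h z then (1 : ℝ) else 0) - 1) :=
    Finset.sum_congr rfl fun z _ => by rw [boolSign_mul]; split_ifs <;> norm_num
  rw [hs, Finset.sum_sub_distrib, ← Finset.mul_sum, Finset.sum_boole]
  simp

/-- The Johnson bound: few members of a family of almost orthogonal functions correlate with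
a given function. -/
theorem card_correlated_le [Nonempty Z] (F : Y → Z → Bool) (h : Z → Bool) (L : Finset Y)
    {δ ε : ℝ} (hδ : 0 ≤ δ) (hε : 0 < ε)
    (hF : ∀ y y', y ≠ y' → corrSum (F y) (F y') ≤ δ * Fintype.card Z)
    (hL : ∀ y ∈ L, ε * Fintype.card Z < corrSum (F y) h) (hεδ : 2 * δ ≤ ε ^ 2) :
    (L.card : ℝ) ≤ 2 / ε ^ 2 := by
  classical
  set N : ℝ := (Fintype.card Z : ℝ) with hN
  have hNpos : 0 < N := by rw [hN]; exact_mod_cast Fintype.card_pos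
  -- Second moment method: the sum of the codewords in `L` correlates strongly with `h`, but almost
  -- orthogonality keeps its norm small, and Cauchy–Schwarz compares the two.
  set S : Z → ℝ := fun z => ∑ y ∈ L, boolSign (F y z)
  have h₁ : ε * N * L.card ≤ ∑ z, S z * boolSign (h z) := by
    calc ε * N * L.card = ∑ y ∈ L, ε * N := by simp; ring
      _ ≤ ∑ y ∈ L, corrSum (F y) h := Finset.sum_le_sum fun y hy => (hL y hy).le
      _ = ∑ z, S z * boolSign (h z) := by
        simp only [corrSum, S, Finset.sum_mul]
        rw [Finset.sum_comm]
  have h₂ : (∑ z, S z * boolSign (h z)) ^ 2 ≤ (∑ z, S z ^ 2) * N := by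
    refine (Finset.sum_mul_sq_le_sq_mul_sq _ _ _).trans (le_of_eq ?_)
    simp [sq, boolSign_mul_self, hN]
  have h₃ : ∑ z, S z ^ 2 = ∑ y ∈ L, ∑ y' ∈ L, corrSum (F y) (F y') := by
    simp only [corrSum, S, sq, Finset.sum_mul_sum]
    rw [Finset.sum_comm]
    refine Finset.sum_congr rfl fun y _ => ?_
    rw [Finset.sum_comm]
  have h₄ : ∑ z, S z ^ 2 ≤ N * L.card + δ * N * L.card ^ 2 := by
    rw [h₃]
    calc ∑ y ∈ L, ∑ y' ∈ L, corrSum (F y) (F y')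
        ≤ ∑ y ∈ L, ∑ y' ∈ L, ((if y = y' then N else 0) + δ * N) := by
          refine Finset.sum_le_sum fun y _ => Finset.sum_le_sum fun y' _ => ?_
          split_ifs with hy
          · subst hy; rw [corrSum_self]; nlinarith
          · rw [zero_add]; exact hF y y' hy
      _ = N * L.card + δ * N * L.card ^ 2 := by
          simp [Finset.sum_add_distrib]; ring
  have hc : (0 : ℝ) ≤ L.card := by positivity
  have h₅ : (ε * N * L.card) ^ 2 ≤ (N * L.card + δ * N * L.card ^ 2) * N :=
    ((pow_le_pow_left₀ (by positivity) h₁ 2).trans h₂).trans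
      (mul_le_mul_of_nonneg_right h₄ hNpos.le)
  rw [le_div_iff₀ (by positivity)]
  rcases hc.eq_or_lt with h0 | h0
  · rw [← h0]; norm_num
  have h₆ : N ^ 2 * L.card * (ε ^ 2 * L.card) ≤ N ^ 2 * L.card * (1 + δ * L.card) := by
    nlinarith
  -- This reads `ε ^ 2 * |L| ≤ 1 + δ * |L|`. The last term is at most half of the left-hand side by
  -- `hεδ`.
  have h₇ := le_of_mul_le_mul_left h₆ (by positivity)
  nlinarith

/-- If `F y` is a family of almost orthogonal functions and every `C y` belongs to the small set
`H`, then `C` agrees with `F` on little more than half of the pairs. -/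
theorem card_agree_le [Nonempty Z] [Fintype Y] (F C : Y → Z → Bool) (H : Finset (Z → Bool))
    (hC : ∀ y, C y ∈ H) {δ ε : ℝ} (hδ : 0 ≤ δ) (hε : 0 < ε)
    (hF : ∀ y y', y ≠ y' → corrSum (F y) (F y') ≤ δ * Fintype.card Z)
    (hεδ : 2 * δ ≤ ε ^ 2) :
    ∑ y, ((Finset.univ.filter fun z => F y z = C y z).card : ℝ) ≤
      (Fintype.card Y * ((1 + ε) / 2) + H.card * (2 / ε ^ 2)) * Fintype.card Z := by
  classical
  set N : ℝ := (Fintype.card Z : ℝ) with hN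
  have hNpos : 0 < N := by rw [hN]; exact_mod_cast Fintype.card_pos
  -- Every bad `y` is counted by the Johnson bound for the function `C y ∈ H`, so a union over `H`
  -- suffices. Bad `y` are given full agreement, the others at most `(1 + ε) / 2`.
  set bad : Finset Y := Finset.univ.filter fun y => ε * N < corrSum (F y) (C y) with hbad
  have hbadcard : (bad.card : ℝ) ≤ H.card * (2 / ε ^ 2) := by
    have hsub : bad ⊆ H.biUnion fun h => Finset.univ.filter fun y => ε * N < corrSum (F y) h := by
      intro y hy
      rw [hbad, Finset.mem_filter] at hy
      exact Finset.mem_biUnion.2 ⟨C y, hC y, Finset.mem_filter.2 hy⟩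
    have h₁ := (Finset.card_le_card hsub).trans Finset.card_biUnion_le
    calc (bad.card : ℝ)
        ≤ ∑ h ∈ H, ((Finset.univ.filter fun y => ε * N < corrSum (F y) h).card : ℝ) := by
          exact_mod_cast h₁
      _ ≤ ∑ h ∈ H, 2 / ε ^ 2 := Finset.sum_le_sum fun h _ =>
          card_correlated_le F h _ hδ hε hF (fun y hy => (Finset.mem_filter.1 hy).2) hεδ
      _ = H.card * (2 / ε ^ 2) := by simp
  calc ∑ y, ((Finset.univ.filter fun z => F y z = C y z).card : ℝ)
      ≤ ∑ y, (N * ((1 + ε) / 2) + if y ∈ bad then N else 0) := by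
        refine Finset.sum_le_sum fun y _ => ?_
        rw [card_agree_eq, ← hN]
        split_ifs with hy
        · have : corrSum (F y) (C y) ≤ N := by
            calc corrSum (F y) (C y) ≤ ∑ z : Z, (1 : ℝ) :=
                  Finset.sum_le_sum fun z _ => by rw [boolSign_mul]; split_ifs <;> norm_num
              _ = N := by simp [hN]
          nlinarith
        · have : corrSum (F y) (C y) ≤ ε * N := by
            by_contra hlt
            exact hy (Finset.mem_filter.2 ⟨Finset.mem_univ _, not_le.1 hlt⟩)
          nlinarith
    _ = (Fintype.card Y * ((1 + ε) / 2) + bad.card) * N := by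
        rw [Finset.sum_add_distrib, Finset.sum_ite_mem]
        simp; ring
    _ ≤ _ := by gcongr

end ListDecoding

/-! ### Binomials of degree a power of two -/

section Binomial

open Polynomial

/-- If `-1` is a square, then `X ^ 2 ^ j - a` is irreducible for every non-square `a`. -/
theorem irreducible_X_pow_two_pow_sub_C {K : Type*} [Field K] {i a : K} (hi : i ^ 2 = -1)
    (ha : ∀ b : K, b ^ 2 ≠ a) (j : ℕ) : Irreducible (X ^ 2 ^ j - C a) := by
  induction j generalizing K with
  | zero => simpa using irreducible_X_sub_C a
  | succ j ih =>
    rw [pow_succ]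
    apply X_pow_mul_sub_C_irreducible (X_pow_sub_C_irreducible_of_prime Nat.prime_two ha)
    intro E _ _ x hx
    have hint : IsIntegral K x := not_not.mp fun h ↦ by
      simpa only [degree_zero, degree_X_pow_sub_C zero_lt_two,
        WithBot.natCast_ne_bot] using congr_arg degree (hx.symm.trans (dif_neg h))
    apply ih (i := algebraMap K _ i) (by rw [← map_pow, hi, map_neg, map_one])
    intro b hb
    -- If `b` were a square root of the generator `√a` of the quadratic extension, then `norm b ^ 2
    -- = norm √a = -a`, and multiplying by `i` would give a square root of `a`.
    apply ha (i * Algebra.norm _ b)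
    rw [mul_pow, hi, ← map_pow, hb, ← IntermediateField.adjoin.powerBasis_gen hint,
      Algebra.PowerBasis.norm_gen_eq_coeff_zero_minpoly]
    simp [IntermediateField.minpoly_gen, hx]

instance fact_prime_five : Fact (Nat.Prime 5) := ⟨by norm_num⟩

/-- A field generated over `𝔽₅` by a `2 ^ j`-th root of `2`, of degree `2 ^ j`. -/
theorem exists_field_root_two (j : ℕ) : ∃ (L : Type) (_ : Field L) (_ : Algebra (ZMod 5) L) (ζ : L),
    ζ ^ 2 ^ j = 2 ∧ LinearIndependent (ZMod 5) fun i : Fin (2 ^ j) => ζ ^ (i : ℕ) := by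
  have hirr : Irreducible (X ^ 2 ^ j - C 2 : (ZMod 5)[X]) :=
    -- Over `𝔽₅` the element `2` plays both roles: its square is `-1`, and it is itself not a
    -- square.
    irreducible_X_pow_two_pow_sub_C (i := 2) (by decide) (by decide) j
  have : Fact (Irreducible (X ^ 2 ^ j - C 2 : (ZMod 5)[X])) := ⟨hirr⟩
  refine ⟨AdjoinRoot (X ^ 2 ^ j - C 2 : (ZMod 5)[X]), inferInstance, inferInstance,
    AdjoinRoot.root _, ?_, ?_⟩
  · have h := AdjoinRoot.eval₂_root (X ^ 2 ^ j - C 2 : (ZMod 5)[X])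
    rw [eval₂_sub, eval₂_pow, eval₂_C, eval₂_X, sub_eq_zero] at h
    exact h.trans (map_ofNat _ 2)
  · have hdeg : (X ^ 2 ^ j - C 2 : (ZMod 5)[X]).natDegree = 2 ^ j := natDegree_X_pow_sub_C
    have h := (AdjoinRoot.powerBasis hirr.ne_zero).basis.linearIndependent
    rw [PowerBasis.coe_basis] at h
    have h' := h.comp (Fin.cast (by rw [AdjoinRoot.powerBasis_dim, hdeg]))
      (Fin.cast_injective _)
    exact h'

end Binomial

/-! ### The code -/

namespace HardFunction

/-- A Boolean value as an element of `𝔽₂`. -/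
def toF2 (b : Bool) : ZMod 2 := if b then 1 else 0

/-- A Boolean value as an element of `𝔽₅`. -/
def toF5 (b : Bool) : ZMod 5 := if b then 1 else 0

/-- The map `0 ↦ 0`, `1 ↦ 1` from `𝔽₂` to `𝔽₅`. -/
def emb (a : ZMod 2) : ZMod 5 := if a = 1 then 1 else 0

/-- The binary digits of an element of `𝔽₅`. -/
def digits (a : ZMod 5) (r : Fin 3) : ZMod 2 := toF2 (a.val.testBit r)

/-- The digit map is not additive, but the Hadamard step only needs different symbols to have
different digits. -/
theorem digits_injective : Function.Injective digits := by
  have : ∀ a b : ZMod 5, (∀ r, digits a r = digits b r) → a = b := by decide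
  exact fun a b h => this a b fun r => congrFun h r

theorem emb_injective : Function.Injective emb := by
  have : ∀ a b : ZMod 2, emb a = emb b → a = b := by decide
  exact this

theorem toF5_injective : Function.Injective toF5 := by
  have : ∀ a b : Bool, toF5 a = toF5 b → a = b := by decide
  exact this

/-- A position of the selector: a coefficient of the evaluation point and a test for one symbol of
the value. -/
abbrev Slot := ZMod 2 × (Fin 3 → ZMod 2)

/-- For a list of coefficients with respect to `1, ζ, …, ζ ^ (e - 1)`, where `ζ ^ e = 2`, the list
of the product with `ζ⁻¹`. -/
def rotate (w : List (ZMod 5)) : List (ZMod 5) := w.tail ++ [3 * w.headD 0]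

/-- The coefficients of `w / ζ + a v`. -/
def rotateAdd (a : ZMod 2) (v w : List (ZMod 5)) : List (ZMod 5) :=
  List.zipWith (fun p r => r + emb a * p) v (rotate w)

/-- The product of `v` and the field element with the digits `α`. -/
def mulBy (α : List (ZMod 2)) (v : List (ZMod 5)) : List (ZMod 5) :=
  α.foldl (fun w a => rotateAdd a v w) (List.replicate v.length 0)

/-- Add a bit to the constant coefficient. -/
def addConst (b : Bool) : List (ZMod 5) → List (ZMod 5)
  | [] => []
  | c :: v => (c + toF5 b) :: v

/-- Horner's scheme at the point with the digits `α`. -/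
def horner (e : ℕ) (α : List (ZMod 2)) (y : List Bool) : List (ZMod 5) :=
  y.foldl (fun v b => addConst b (mulBy α v)) (List.replicate e 0)

/-- The test applied to one symbol. -/
def testSymbol (p : ZMod 5) (s : Slot) : ZMod 2 := ∑ r, digits p r * s.2 r

/-- The bit of the codeword of `y` (the most significant coefficient first) at the position `z`. -/
def codeBit (y : List Bool) (z : List Slot) : ZMod 2 :=
  (List.zipWith testSymbol (horner z.length (z.map Prod.fst) y) z).sum

/-! ### Lengths of coefficient lists. -/

section Length

theorem length_rotate {w : List (ZMod 5)} (hw : w ≠ []) : (rotate w).length = w.length := by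
  cases w <;> simp_all [rotate]

theorem length_rotateAdd (a : ZMod 2) {v w : List (ZMod 5)} (hw : w.length = v.length) :
    (rotateAdd a v w).length = v.length := by
  cases w <;> cases v <;> simp_all [rotateAdd, rotate]

theorem length_foldl_rotateAdd (α : List (ZMod 2)) {v w : List (ZMod 5)}
    (hw : w.length = v.length) :
    (α.foldl (fun w a => rotateAdd a v w) w).length = v.length := by
  induction α generalizing w with
  | nil => exact hw
  | cons a α ih => exact ih (length_rotateAdd a hw)

theorem length_mulBy (α : List (ZMod 2)) (v : List (ZMod 5)) :
    (mulBy α v).length = v.length :=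
  length_foldl_rotateAdd α (by simp)

theorem length_addConst (b : Bool) (v : List (ZMod 5)) : (addConst b v).length = v.length := by
  cases v <;> rfl

theorem length_foldl_horner (α : List (ZMod 2)) (y : List Bool) (v : List (ZMod 5)) :
    (y.foldl (fun v b => addConst b (mulBy α v)) v).length = v.length := by
  induction y generalizing v with
  | nil => rfl
  | cons b y ih => rw [List.foldl_cons, ih, length_addConst, length_mulBy]

theorem length_horner (e : ℕ) (α : List (ZMod 2)) (y : List Bool) :
    (horner e α y).length = e := by
  rw [horner, length_foldl_horner, List.length_replicate]

end Length

/-! ### Coefficient lists as field elements. -/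

section Value

variable {L : Type*} [Field L] [Algebra (ZMod 5) L] (ζ : L)

/-- The field element with the given list of coefficients. -/
def value : List (ZMod 5) → L
  | [] => 0
  | c :: v => algebraMap (ZMod 5) L c + ζ * value v

theorem value_append_singleton (v : List (ZMod 5)) (c : ZMod 5) :
    value ζ (v ++ [c]) = value ζ v + ζ ^ v.length * algebraMap (ZMod 5) L c := by
  induction v with
  | nil => simp [value]
  | cons d v ih => rw [List.cons_append, value, ih, value, List.length_cons, pow_succ]; ring

theorem value_zipWith (b : ZMod 5) {v w : List (ZMod 5)} (h : w.length = v.length) :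
    value ζ (List.zipWith (fun p r => r + b * p) v w) =
      value ζ w + algebraMap (ZMod 5) L b * value ζ v := by
  induction v generalizing w with
  | nil => cases w <;> simp_all [value]
  | cons p v ih =>
    cases w with
    | nil => simp at h
    | cons r w =>
      rw [List.zipWith_cons_cons, value, ih (by simpa using h), value, value, map_add, map_mul]
      ring

theorem value_replicate_zero (m : ℕ) : value ζ (List.replicate m 0) = 0 := by
  induction m with
  | zero => rfl
  | succ m ih => rw [List.replicate_succ, value, ih]; simp

theorem value_ofFn {e : ℕ} (c : Fin e → ZMod 5) :
    value ζ (List.ofFn c) = ∑ i, c i • ζ ^ (i : ℕ) := by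
  induction e with
  | zero => simp [value]
  | succ e ih =>
    rw [List.ofFn_succ, value, ih, Fin.sum_univ_succ, Finset.mul_sum]
    simp only [Algebra.smul_def, Fin.val_zero, pow_zero, mul_one, Fin.val_succ, pow_succ]
    congr 1
    exact Finset.sum_congr rfl fun i _ => by ring

variable {ζ} {e : ℕ} (hζ : ζ ^ e = 2) (hζ0 : ζ ≠ 0)
include hζ hζ0

/-- Since `2 * 3 = 1` in `𝔽₅` and `ζ ^ e = 2`, one has `ζ⁻¹ * c = 3 * c * ζ ^ (e - 1)`: the constant
coefficient moves to the other end with a factor `3`. -/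
theorem value_rotate {w : List (ZMod 5)} (hw : w.length = e) (he : w ≠ []) :
    value ζ (rotate w) = ζ⁻¹ * value ζ w := by
  cases w with
  | nil => exact absurd rfl he
  | cons c w =>
    rw [eq_inv_mul_iff_mul_eq₀ hζ0]
    simp only [rotate, List.tail_cons, List.headD_cons, value_append_singleton, value]
    have h₁ : ζ * (ζ ^ w.length * algebraMap (ZMod 5) L (3 * c)) =
        algebraMap (ZMod 5) L c := by
      rw [← mul_assoc, ← pow_succ', ← List.length_cons (a := c), hw, hζ,
        ← map_ofNat (algebraMap (ZMod 5) L) 2, ← map_mul, ← mul_assoc]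
      congr 1
      exact (by decide : ∀ c : ZMod 5, 2 * 3 * c = c) c
    rw [mul_add, h₁, add_comm]

/-- The field element with the digits `α`. -/
def point (ζ : L) (α : List (ZMod 2)) : L :=
  α.foldl (fun s a => ζ⁻¹ * s + algebraMap (ZMod 5) L (emb a)) 0

theorem value_mulBy (α : List (ZMod 2)) {v : List (ZMod 5)} (hv : v.length = e) (he : e ≠ 0) :
    value ζ (mulBy α v) = point ζ α * value ζ v := by
  have key : ∀ (w : List (ZMod 5)) (s : L), w.length = e → value ζ w = s * value ζ v →
      value ζ (α.foldl (fun w a => rotateAdd a v w) w) =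
        α.foldl (fun s a => ζ⁻¹ * s + algebraMap (ZMod 5) L (emb a)) s * value ζ v := by
    induction α with
    | nil => exact fun w s _ h => h
    | cons a α ih =>
      intro w s hw h
      have hne : w ≠ [] := by rintro rfl; exact he hw.symm
      refine ih _ _ ((length_rotateAdd a (hw.trans hv.symm)).trans hv) ?_
      change value ζ (List.zipWith _ v (rotate w)) = _
      rw [value_zipWith ζ _ ((length_rotate hne).trans (hw.trans hv.symm)),
        value_rotate hζ hζ0 hw hne, h]
      ring
  exact key _ 0 (by simpa using hv) (by rw [value_replicate_zero, zero_mul])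

theorem value_horner (α : List (ZMod 2)) (y : List Bool) (he : e ≠ 0) :
    value ζ (horner e α y) =
      y.foldl (fun s b => point ζ α * s + algebraMap (ZMod 5) L (toF5 b)) 0 := by
  have key : ∀ (v : List (ZMod 5)), v.length = e →
      value ζ (y.foldl (fun v b => addConst b (mulBy α v)) v) =
        y.foldl (fun s b => point ζ α * s + algebraMap (ZMod 5) L (toF5 b)) (value ζ v) := by
    induction y with
    | nil => exact fun v _ => rfl
    | cons b y ih =>
      intro v hv
      have hlen : (mulBy α v).length = e := (length_mulBy α v).trans hv
      rw [List.foldl_cons, List.foldl_cons, ih _ ((length_addConst b _).trans hlen),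
        ← value_mulBy hζ hζ0 α hv he]
      congr 1
      cases hm : mulBy α v with
      | nil => rw [hm] at hlen; exact absurd hlen.symm he
      | cons c t => rw [addConst, value, value, map_add]; ring
  rw [horner, key _ List.length_replicate, value_replicate_zero]

/-- Folding with `ζ⁻¹` yields negative powers of `ζ`. Clearing them gives a combination of the basis
`1, ζ, …, ζ ^ (e - 1)`, from which the digits can be recovered. -/
theorem point_ofFn (α : Fin e → ZMod 2) (he : e ≠ 0) :
    ζ ^ (e - 1) * point ζ (List.ofFn α) = ∑ i, emb (α i) • ζ ^ (i : ℕ) := by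
  have key : ∀ l : List (ZMod 2), ζ ^ l.length * point ζ l = ζ * value ζ (l.map emb) := by
    intro l
    induction l using List.reverseRecOn with
    | nil => simp [point, value]
    | append_singleton l a ih =>
      rw [point, List.foldl_append, List.foldl_cons, List.foldl_nil, ← point, List.map_append,
        List.map_singleton, value_append_singleton, List.length_map, List.length_append,
        List.length_singleton, pow_succ, mul_add, mul_add, ← ih]
      field_simp
  have h := key (List.ofFn α)
  rw [List.map_ofFn, value_ofFn, List.length_ofFn] at h
  obtain ⟨e, rfl⟩ := Nat.exists_eq_succ_of_ne_zero he
  refine mul_left_cancel₀ hζ0 (Eq.trans ?_ h)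
  rw [Nat.succ_sub_one, pow_succ]
  ring

end Value

/-! ### Almost orthogonality of the codewords. -/

section Distance

variable {e : ℕ}

theorem zipWith_ofFn {α β γ : Type*} (f : α → β → γ) (a : Fin e → α) (b : Fin e → β) :
    List.zipWith f (List.ofFn a) (List.ofFn b) = List.ofFn fun i => f (a i) (b i) :=
  List.ext_get (by simp) (by simp)

/-- Distinct messages have the same value at few points. -/
theorem card_horner_eq_le {j m : ℕ} {y y' : Fin m → Bool} (hy : y ≠ y') :
    (Finset.univ.filter fun α : Fin (2 ^ j) → ZMod 2 =>
      horner (2 ^ j) (List.ofFn α) (List.ofFn y).reverse =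
        horner (2 ^ j) (List.ofFn α) (List.ofFn y').reverse).card ≤ m := by
  classical
  obtain ⟨L, _, _, ζ, hζ, hind⟩ := exists_field_root_two j
  have he : 2 ^ j ≠ 0 := by positivity
  have hζ0 : ζ ≠ 0 := by
    rintro rfl
    rw [zero_pow he, ← map_ofNat (algebraMap (ZMod 5) L) 2, eq_comm,
      map_eq_zero_iff _ (algebraMap (ZMod 5) L).injective] at hζ
    exact absurd hζ (by decide)
  -- The difference of the two message polynomials. Evaluation points with equal values are roots of
  -- it, and distinct digit vectors give distinct points by `hinj`.
  let P : Polynomial L := ∑ i : Fin m, Polynomial.monomial (i : ℕ)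
    (algebraMap (ZMod 5) L (toF5 (y i) - toF5 (y' i)))
  have hP : P ≠ 0 := by
    obtain ⟨i, hi⟩ := Function.ne_iff.1 hy
    intro h0
    have hc := congrArg (fun p => Polynomial.coeff p (i : ℕ)) h0
    simp only [P, Polynomial.finsetSum_coeff, Polynomial.coeff_monomial, Fin.val_inj,
      Finset.sum_ite_eq', Finset.mem_univ, if_true, Polynomial.coeff_zero] at hc
    rw [map_eq_zero_iff _ (algebraMap (ZMod 5) L).injective, sub_eq_zero] at hc
    exact hi (toF5_injective hc)
  have hdeg : P.natDegree ≤ m :=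
    Polynomial.natDegree_sum_le_of_forall_le _ _ fun i _ =>
      (Polynomial.natDegree_monomial_le _).trans i.2.le
  have heval : ∀ (A : L) (x : Fin m → Bool),
      (List.ofFn x).reverse.foldl (fun s b => A * s + algebraMap (ZMod 5) L (toF5 b)) 0 =
        ∑ i : Fin m, algebraMap (ZMod 5) L (toF5 (x i)) * A ^ (i : ℕ) := by
    intro A x
    rw [List.foldl_reverse]
    clear hP hdeg P hy y y'
    induction m with
    | zero => simp
    | succ m ih =>
      rw [List.ofFn_succ, List.foldr_cons, ih, Fin.sum_univ_succ, Finset.mul_sum, add_comm]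
      simp only [Fin.val_zero, pow_zero, mul_one, Fin.val_succ, pow_succ]
      congr 1
      exact Finset.sum_congr rfl fun i _ => by ring
  have hinj : Function.Injective fun α : Fin (2 ^ j) → ZMod 2 => point ζ (List.ofFn α) := by
    intro α α' h
    have h₁ := point_ofFn hζ hζ0 α he
    have h₂ := point_ofFn hζ hζ0 α' he
    simp only at h
    rw [h, h₂] at h₁
    have h₃ := Fintype.linearIndependent_iff.1 hind (fun i => emb (α' i) - emb (α i))
      (by simp only [sub_smul, Finset.sum_sub_distrib, h₁, sub_self])
    funext i
    exact emb_injective (sub_eq_zero.1 (h₃ i)).symm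
  calc _ ≤ (P.roots.toFinset).card := by
        refine Finset.card_le_card_of_injOn (fun α => point ζ (List.ofFn α)) ?_ hinj.injOn
        intro α hα
        have hα' := congrArg (value ζ) (Finset.mem_filter.1 (Finset.mem_coe.1 hα)).2
        rw [value_horner hζ hζ0 _ _ he, value_horner hζ hζ0 _ _ he, heval, heval, ← sub_eq_zero,
          ← Finset.sum_sub_distrib] at hα'
        simp only [Finset.mem_coe, Multiset.mem_toFinset, Polynomial.mem_roots hP,
          Polynomial.IsRoot.def, P, Polynomial.eval_finsetSum, Polynomial.eval_monomial]
        rw [← hα']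
        exact Finset.sum_congr rfl fun i _ => by rw [map_sub]; ring
    _ ≤ P.roots.card := Multiset.toFinset_card_le _
    _ ≤ P.natDegree := Polynomial.card_roots' P
    _ ≤ m := hdeg

/-- The code as a family of Boolean functions of the selector. -/
def codeFn (m e : ℕ) (y : Fin m → Bool) (z : Fin e → Slot) : Bool :=
  decide (codeBit (List.ofFn y).reverse (List.ofFn z) = 1)

theorem codeBit_ofFn (y : List Bool) (z : Fin e → Slot) (v : Fin e → ZMod 5)
    (hv : horner e ((List.ofFn z).map Prod.fst) y = List.ofFn v) :
    codeBit y (List.ofFn z) = ∑ i, testSymbol (v i) (z i) := by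
  rw [codeBit, List.length_ofFn, hv, zipWith_ofFn, List.sum_ofFn]

theorem boolSign_decide_mul (a b : ZMod 2) :
    boolSign (decide (a = 1)) * boolSign (decide (b = 1)) = if a + b = 0 then 1 else -1 := by
  have : ∀ a b : ZMod 2, (decide (a = 1) = decide (b = 1)) ↔ a + b = 0 := by decide
  rw [boolSign_mul]
  simp only [this]

/-- Translation by `b` is a bijection that changes every sign, so the sum equals its negative. -/
theorem sum_sign_eq_zero {B : Type*} [Fintype B] [AddCommGroup B] (f : B → ZMod 2) (b : B)
    (hb : ∀ x, f (x + b) = f x + 1) : ∑ x, (if f x = 0 then (1 : ℝ) else -1) = 0 := by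
  have h : ∀ a : ZMod 2, (if a + 1 = 0 then (1 : ℝ) else -1) = -(if a = 0 then 1 else -1) := by
    intro a
    have : a = 0 ∨ a = 1 := by revert a; decide
    rcases this with rfl | rfl
    · simp
    · rw [if_pos (by decide), if_neg (by decide), neg_neg]
  have h₁ : ∑ x, (if f x = 0 then (1 : ℝ) else -1) = -∑ x, (if f x = 0 then (1 : ℝ) else -1) := by
    rw [← Finset.sum_neg_distrib, ← Equiv.sum_comp (Equiv.addRight b)]
    exact Finset.sum_congr rfl fun x _ => by rw [Equiv.coe_addRight, hb, h]
  linarith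

/-- Distinct codewords are almost orthogonal. -/
theorem corrSum_codeFn_le {j m : ℕ} {y y' : Fin m → Bool} (hy : y ≠ y') :
    corrSum (codeFn m (2 ^ j) y) (codeFn m (2 ^ j) y') ≤
      (m / 2 ^ 2 ^ j : ℝ) * Fintype.card (Fin (2 ^ j) → Slot) := by
  classical
  set e := 2 ^ j with he
  let E := Equiv.arrowProdEquivProdArrow (Fin e) (fun _ => ZMod 2) (fun _ => Fin 3 → ZMod 2)
  have hcard : Fintype.card (Fin e → Slot) =
      2 ^ e * Fintype.card (Fin e → Fin 3 → ZMod 2) := by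
    rw [Fintype.card_congr E, Fintype.card_prod]
    congr 1
    simp
  set v : (Fin m → Bool) → (Fin e → ZMod 2) → Fin e → ZMod 5 := fun y α i =>
    (horner e (List.ofFn α) (List.ofFn y).reverse).get (Fin.cast (length_horner _ _ _).symm i)
    with hv
  have hvl : ∀ y α, horner e (List.ofFn α) (List.ofFn y).reverse = List.ofFn (v y α) :=
    fun y α => List.ext_get (by simp [length_horner]) (by simp [hv])
  have hbit : ∀ y α β, codeBit (List.ofFn y).reverse (List.ofFn (E.symm (α, β))) =
      ∑ i, ∑ r, digits (v y α i) r * β i r := fun y α β => by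
    rw [codeBit_ofFn _ _ (v y α)]
    · rfl
    · rw [List.map_ofFn, ← hvl]; rfl
  have hcorr : corrSum (codeFn m e y) (codeFn m e y') = ∑ α, ∑ β : Fin e → Fin 3 → ZMod 2,
      if ∑ i, ∑ r, (digits (v y α i) r + digits (v y' α i) r) * β i r = 0 then (1 : ℝ)
        else -1 := by
    rw [corrSum, ← Equiv.sum_comp E.symm, Fintype.sum_prod_type]
    refine Finset.sum_congr rfl fun α _ => Finset.sum_congr rfl fun β _ => ?_
    rw [codeFn, codeFn, boolSign_decide_mul, hbit, hbit, ← Finset.sum_add_distrib]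
    simp only [← Finset.sum_add_distrib, add_mul]
  have hrow : ∀ α, ∑ β : Fin e → Fin 3 → ZMod 2,
      (if ∑ i, ∑ r, (digits (v y α i) r + digits (v y' α i) r) * β i r = 0 then (1 : ℝ)
        else -1) ≤ if v y α = v y' α then (Fintype.card (Fin e → Fin 3 → ZMod 2) : ℝ) else 0 := by
    intro α
    split_ifs with h
    · refine (Finset.sum_le_card_nsmul _ _ 1 fun β _ => ?_).trans (by simp)
      split_ifs <;> norm_num
    -- The values differ in digit `r` of some symbol `i`, so the linear form in `β` is nonzero.
    -- Translating by the unit vector at `(i, r)` flips it.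
    · obtain ⟨i, hi⟩ := Function.ne_iff.1 h
      obtain ⟨r, hr⟩ := Function.ne_iff.1 (digits_injective.ne hi)
      have hone : digits (v y α i) r + digits (v y' α i) r = 1 := by
        have : ∀ a b : ZMod 2, a ≠ b → a + b = 1 := by decide
        exact this _ _ hr
      refine (sum_sign_eq_zero _ (Pi.single i (Pi.single r 1)) fun β => ?_).le
      simp only [Pi.add_apply, mul_add, Finset.sum_add_distrib]
      congr 1
      rw [Finset.sum_eq_single i, Finset.sum_eq_single r, Pi.single_eq_same, Pi.single_eq_same,
        hone, one_mul]
      · intro s _ hs; rw [Pi.single_eq_same, Pi.single_eq_of_ne hs, mul_zero]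
      · simp
      · intro k _ hk
        rw [Pi.single_eq_of_ne hk]; simp
      · simp
  calc corrSum (codeFn m e y) (codeFn m e y')
      ≤ ∑ α, if v y α = v y' α then (Fintype.card (Fin e → Fin 3 → ZMod 2) : ℝ) else 0 := by
        rw [hcorr]; exact Finset.sum_le_sum fun α _ => hrow α
    _ = ((Finset.univ.filter fun α => v y α = v y' α).card : ℝ) *
          Fintype.card (Fin e → Fin 3 → ZMod 2) := by
        rw [← Finset.sum_filter, Finset.sum_const, nsmul_eq_mul]
    _ ≤ m * Fintype.card (Fin e → Fin 3 → ZMod 2) := by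
        gcongr
        refine le_trans (Finset.card_le_card fun α hα => ?_) (card_horner_eq_le hy)
        rw [Finset.mem_filter] at hα ⊢
        exact ⟨hα.1, by rw [hvl, hvl, hα.2]⟩
    _ = _ := by rw [hcard]; push_cast; field_simp

end Distance

end HardFunction

/-! ### The hard function -/

namespace HardFunction

/-- The bit at position `i`, or `false` beyond the end of the list. -/
def bitAt (r : List Bool) (i : ℕ) : Bool := r.getD i false

/-- The selector symbol in the `i`-th group of five bits. -/
def slotAt (r : List Bool) (i : ℕ) : Slot :=
  (toF2 (bitAt r (5 * i + 1)), fun s => toF2 (bitAt r (5 * i + 2 + s)))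

/-- The message: the first bits of the groups of five bits. -/
def message (r : List Bool) : List Bool :=
  (List.range (r.length / 5)).map fun i => bitAt r (5 * i)

/-- The selector: the sum of the consecutive blocks of `e` selector symbols. -/
def selector (e : ℕ) (r : List Bool) : List Slot :=
  List.ofFn fun j : Fin e => ∑ i ∈ (Finset.range (r.length / 5)).filter (· % e = j), slotAt r i

/-- The hard function: a bit of the encoded message if the input consists of sufficiently many
blocks of length `2 ^ L`, where `L` is the number of binary digits of `k`, and the parity
otherwise. -/
def hardFn (k : ℕ) (x : List Bool) : Bool :=
  if 32 * 2 ^ (Computability.encodeNat k).length ≤ x.length then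
    decide (codeBit (message x.reverse).reverse
      (selector (2 ^ (Computability.encodeNat k).length) x.reverse) = 1)
  else decide ((x.map toF2).sum = 1)

theorem toF2_xor (a b : Bool) : toF2 (xor a b) = toF2 a + toF2 b := by
  revert a b; decide

theorem bitAt_reverse_ofFn {n : ℕ} (x : Fin n → Bool) {p : ℕ} (hp : p < n) :
    bitAt (List.ofFn x).reverse p = x (Fin.rev ⟨p, hp⟩) := by
  rw [bitAt, List.getD_eq_getElem _ _ (by simpa using hp)]
  simp [Fin.rev, Nat.sub_sub, Nat.add_comm]

/-! ### Shifting an input by a message and a block. -/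

section Shift

variable {n e : ℕ} (he : 0 < e) (b : ℕ)

/-- The bits of a selector symbol. -/
def slotBit (s : Slot) (o : ℕ) : Bool :=
  decide ((if o = 1 then s.1 else s.2 (Fin.ofNat 3 (o - 2))) = 1)

/-- The input with message `y`, selector symbols `t` in the block number `b`, and `false`
elsewhere. -/
def place (n : ℕ) (he : 0 < e) (b : ℕ) (y : Fin (n / 5) → Bool) (t : Fin e → Slot) (i : Fin n) :
    Bool :=
  if i.rev.val % 5 = 0 then
    if h : i.rev.val / 5 < n / 5 then y ⟨i.rev.val / 5, h⟩ else false
  else if i.rev.val / 5 / e = b then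
    slotBit (t ⟨i.rev.val / 5 % e, Nat.mod_lt _ he⟩) (i.rev.val % 5)
  else false

/-- The variables of the block number `b`. -/
def blockVars (n e b : ℕ) : Finset (Fin n) :=
  Finset.univ.filter fun i => i.rev.val % 5 ≠ 0 ∧ i.rev.val / 5 / e = b

/-- The shift of an input by `place`. -/
def shiftInput (he : 0 < e) (b : ℕ) (x : Fin n → Bool) (y : Fin (n / 5) → Bool)
    (t : Fin e → Slot) : Fin n → Bool :=
  fun i => xor (x i) (place n he b y t i)

theorem toF2_slotBit_one (s : Slot) : toF2 (slotBit s 1) = s.1 := by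
  have : ∀ a : ZMod 2, toF2 (decide (a = 1)) = a := by decide
  simp [slotBit, this]

theorem toF2_slotBit_add_two (s : Slot) (r : Fin 3) : toF2 (slotBit s (2 + r)) = s.2 r := by
  have : ∀ a : ZMod 2, toF2 (decide (a = 1)) = a := by decide
  have h : (2 + r.val : ℕ) ≠ 1 := by omega
  simp [slotBit, this, h]

theorem bitAt_shiftInput (x : Fin n → Bool) (y : Fin (n / 5) → Bool) (t : Fin e → Slot) {i o : ℕ}
    (hi : i < n / 5) (ho : o < 5) :
    bitAt (List.ofFn (shiftInput he b x y t)).reverse (5 * i + o) =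
      xor (bitAt (List.ofFn x).reverse (5 * i + o))
        (if o = 0 then y ⟨i, hi⟩ else
          if i / e = b then slotBit (t ⟨i % e, Nat.mod_lt _ he⟩) o else false) := by
  have hp : 5 * i + o < n := by omega
  have h₁ : (5 * i + o) % 5 = o := by omega
  have h₂ : (5 * i + o) / 5 = i := by omega
  rw [bitAt_reverse_ofFn _ hp, bitAt_reverse_ofFn _ hp, shiftInput, place]
  simp only [Fin.rev_rev, h₁, h₂, hi, dif_pos]

theorem message_eq_ofFn (x : Fin n → Bool) :
    message (List.ofFn x).reverse =
      List.ofFn fun i : Fin (n / 5) => bitAt (List.ofFn x).reverse (5 * i) := by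
  refine List.ext_get (by simp [message]) fun i h₁ h₂ => ?_
  simp [message]

theorem message_shiftInput (x : Fin n → Bool) (y : Fin (n / 5) → Bool) (t : Fin e → Slot) :
    message (List.ofFn (shiftInput he b x y t)).reverse =
      List.ofFn fun i : Fin (n / 5) => xor (bitAt (List.ofFn x).reverse (5 * i)) (y i) := by
  rw [message_eq_ofFn]
  congr 1
  funext i
  have h := bitAt_shiftInput he b x y t i.2 (o := 0) (by norm_num)
  simpa using h

theorem slotAt_shiftInput (x : Fin n → Bool) (y : Fin (n / 5) → Bool) (t : Fin e → Slot) {i : ℕ}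
    (hi : i < n / 5) :
    slotAt (List.ofFn (shiftInput he b x y t)).reverse i =
      slotAt (List.ofFn x).reverse i +
        if i / e = b then t ⟨i % e, Nat.mod_lt _ he⟩ else 0 := by
  refine Prod.ext ?_ (funext fun r => ?_)
  · simp only [slotAt, Prod.fst_add]
    rw [bitAt_shiftInput he b x y t hi (by norm_num), toF2_xor, if_neg one_ne_zero]
    split_ifs
    · rw [toF2_slotBit_one]
    · rfl
  · simp only [slotAt, Prod.snd_add, Pi.add_apply]
    rw [add_assoc, bitAt_shiftInput he b x y t hi (by omega), toF2_xor, if_neg (by omega)]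
    split_ifs
    · rw [toF2_slotBit_add_two]
    · rfl

/-- The block contains exactly one index congruent to `j` modulo `e`, namely `e * b + j`, and `hb`
keeps it in range. So one block alone translates the selector by an arbitrary `t`. -/
theorem selector_shiftInput (hb : b < n / 5 / e) (x : Fin n → Bool) (y : Fin (n / 5) → Bool)
    (t : Fin e → Slot) :
    selector e (List.ofFn (shiftInput he b x y t)).reverse =
      List.ofFn fun j : Fin e =>
        (∑ i ∈ (Finset.range (n / 5)).filter (· % e = j), slotAt (List.ofFn x).reverse i) +
          t j := by
  rw [selector]
  congr 1
  funext j
  simp only [List.length_reverse, List.length_ofFn]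
  rw [Finset.sum_congr rfl fun i hi => slotAt_shiftInput he b x y t
    (Finset.mem_range.1 (Finset.mem_filter.1 hi).1), Finset.sum_add_distrib]
  congr 1
  have hlt : e * b + j < n / 5 := by
    have h₁ : e * (b + 1) ≤ e * (n / 5 / e) := Nat.mul_le_mul_left e hb
    have h₂ := Nat.mul_div_le (n / 5) e
    have h₃ := j.2
    rw [mul_add] at h₁
    omega
  have hdiv : (e * b + j) / e = b := by
    rw [Nat.mul_add_div he, Nat.div_eq_of_lt j.2, add_zero]
  have hmod : (e * b + j) % e = j := by
    rw [Nat.mul_add_mod, Nat.mod_eq_of_lt j.2]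
  rw [Finset.sum_eq_single (e * b + j.val)]
  · rw [if_pos hdiv]
    congr 1
    exact Fin.ext hmod
  · intro i hi hne
    rw [if_neg]
    intro hib
    apply hne
    rw [← Nat.div_add_mod i e, hib, (Finset.mem_filter.1 hi).2]
  · intro h
    exact absurd (Finset.mem_filter.2 ⟨Finset.mem_range.2 hlt, hmod⟩) h

/-- Block variables carry no message bits. This makes the set of functions arising from the circuit
independent of the message. -/
theorem place_of_mem {i : Fin n} (hi : i ∈ blockVars n e b) (y y' : Fin (n / 5) → Bool)
    (t : Fin e → Slot) : place n he b y t i = place n he b y' t i := by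
  have h := (Finset.mem_filter.1 hi).2
  rw [place, place, if_neg h.1, if_neg h.1]

theorem place_of_notMem {i : Fin n} (hi : i ∉ blockVars n e b) (y : Fin (n / 5) → Bool)
    (t t' : Fin e → Slot) : place n he b y t i = place n he b y t' i := by
  by_cases h₁ : i.rev.val % 5 = 0
  · simp only [place, if_pos h₁]
  · have h₂ : ¬ i.rev.val / 5 / e = b := fun h₂ =>
      hi (Finset.mem_filter.2 ⟨Finset.mem_univ _, h₁, h₂⟩)
    simp only [place, if_neg h₁, if_neg h₂]

theorem shiftInput_bijective (y : Fin (n / 5) → Bool) (t : Fin e → Slot) :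
    Function.Bijective fun x : Fin n → Bool => shiftInput he b x y t := by
  refine Function.Involutive.bijective fun x => funext fun i => ?_
  simp [shiftInput]

end Shift

/-! ### The lower bounds -/

section LowerBound

variable {n : ℕ} (C : ComparatorCircuit n)

/-- Averaging over the shifts of the inputs. -/
theorem card_eq_code_le {j ℓ : ℕ} (C : ComparatorCircuit n) {ε : ℝ} (hε : 0 < ε)
    (hεδ : 2 * ((n / 5 : ℕ) / 2 ^ 2 ^ j : ℝ) ≤ ε ^ 2)
    (hℓ : C.touchedWires.card < n / 5 / 2 ^ j * (ℓ + 1)) :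
    ((Finset.univ.filter fun x : Fin n → Bool =>
      decide (codeBit (message (List.ofFn x).reverse).reverse
        (selector (2 ^ j) (List.ofFn x).reverse) = 1) = C.eval x).card : ℝ) ≤
      2 ^ n * ((1 + ε) / 2 +
        ((ℓ ^ 2 + 1) ^ ℓ ^ 2 * (ℓ + 2) : ℕ) * (2 / ε ^ 2) / 2 ^ (n / 5)) := by
  classical
  have he : 0 < 2 ^ j := by positivity
  -- Pigeonhole over the complete blocks. The fibre also counts wires labelled by message bits,
  -- which can only overestimate `N`.
  obtain ⟨b, hb, hbN⟩ := Finset.exists_card_fiber_lt_of_card_lt_mul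
    (s := C.touchedWires) (t := Finset.range (n / 5 / 2 ^ j)) (n := ℓ + 1)
    (f := fun w => (C.label w).1.rev.val / 5 / 2 ^ j) (by simpa using hℓ)
  rw [Finset.mem_range] at hb
  set N := C.touchedWires.filter fun w => (C.label w).1 ∈ blockVars n (2 ^ j) b with hN
  have hNcard : N.card ≤ ℓ := by
    refine Nat.le_of_lt_succ (lt_of_le_of_lt (Finset.card_le_card fun w hw => ?_) hbN)
    rw [hN, Finset.mem_filter] at hw
    exact Finset.mem_filter.2 ⟨hw.1, (Finset.mem_filter.1 hw.2).2.2⟩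
  set f : (Fin n → Bool) → Bool := fun x => decide (codeBit (message (List.ofFn x).reverse).reverse
    (selector (2 ^ j) (List.ofFn x).reverse) = 1) with hf
  set Y := Fin (n / 5) → Bool
  set Z := Fin (2 ^ j) → Slot
  have hpoint : ∀ x : Fin n → Bool,
      ∑ y : Y, ((Finset.univ.filter fun t : Z =>
        f (shiftInput he b x y t) = C.eval (shiftInput he b x y t)).card : ℝ) ≤
      (Fintype.card Y * ((1 + ε) / 2) +
        ((ℓ ^ 2 + 1) ^ ℓ ^ 2 * (ℓ + 2) : ℕ) * (2 / ε ^ 2)) * Fintype.card Z := by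
    intro x
    set y₀ : Y := fun i => bitAt (List.ofFn x).reverse (5 * i)
    set z₀ : Z := fun i => ∑ k ∈ (Finset.range (n / 5)).filter (· % 2 ^ j = i.val),
      slotAt (List.ofFn x).reverse k
    have hfx : ∀ y t, f (shiftInput he b x y t) =
        codeFn (n / 5) (2 ^ j) (fun i => xor (y₀ i) (y i)) (z₀ + t) := fun y t => by
      simp only [hf, message_shiftInput, selector_shiftInput he b hb]
      rfl
    -- The zero message serves as representative: wires in `N` start with the same function of `t`
    -- for every `y`.
    set H := networkFunctions N fun w (t : Z) =>
      C.initial (shiftInput he b x (fun _ => false) t) w with hH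
    have hHcard : H.card ≤ (ℓ ^ 2 + 1) ^ ℓ ^ 2 * (ℓ + 2) := by
      refine (card_networkFunctions_le N _).trans ?_
      gcongr ?_ * (?_ + 2)
      have h2 : N.card ^ 2 ≤ ℓ ^ 2 := Nat.pow_le_pow_left hNcard 2
      -- The added `1` keeps the base positive, so the power is monotone in the exponent even for `ℓ
      -- = 0`.
      exact (Nat.pow_le_pow_left (h2.trans (Nat.le_succ _)) _).trans
        (Nat.pow_le_pow_right (Nat.succ_pos _) h2)
    have hmain := card_agree_le
      (fun (y : Y) (t : Z) => codeFn (n / 5) (2 ^ j) (fun i => xor (y₀ i) (y i)) (z₀ + t))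
      (fun y t => C.eval (shiftInput he b x y t)) H
      (fun y => C.eval_mem_networkFunctions (blockVars n (2 ^ j) b) _ _
        (fun t i hi => by
          simp only [shiftInput]; rw [place_of_mem he b hi y (fun _ => false)])
        (fun i hi => ⟨shiftInput he b x y 0 i, fun t => by
          simp only [shiftInput]; rw [place_of_notMem he b hi y t 0]⟩))
      (δ := ((n / 5 : ℕ) / 2 ^ 2 ^ j : ℝ)) (by positivity) hε
      (fun y y' hy => by
        have hne : (fun i => xor (y₀ i) (y i)) ≠ fun i => xor (y₀ i) (y' i) := fun h =>
          hy (funext fun i => by simpa using congrFun h i)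
        refine le_trans (le_of_eq ?_) (corrSum_codeFn_le hne)
        exact Equiv.sum_comp (Equiv.addLeft z₀) fun t =>
          boolSign (codeFn (n / 5) (2 ^ j) (fun i => xor (y₀ i) (y i)) t) *
            boolSign (codeFn (n / 5) (2 ^ j) (fun i => xor (y₀ i) (y' i)) t))
      hεδ
    simp only [hfx]
    refine hmain.trans ?_
    gcongr
  set A : ℝ := ((Finset.univ.filter fun x => f x = C.eval x).card : ℝ) with hA
  have hsum : (Fintype.card Y : ℝ) * Fintype.card Z * A ≤
      2 ^ n * ((Fintype.card Y * ((1 + ε) / 2) +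
        ((ℓ ^ 2 + 1) ^ ℓ ^ 2 * (ℓ + 2) : ℕ) * (2 / ε ^ 2)) * Fintype.card Z) := by
    -- Each fixed shift permutes the inputs, so the agreement count is unchanged, and averaging the
    -- pointwise bound over all `x` bounds it.
    have hA' : ∀ (y : Y) (t : Z), A = ∑ x, if f (shiftInput he b x y t) =
        C.eval (shiftInput he b x y t) then (1 : ℝ) else 0 := fun y t => by
      rw [hA, (shiftInput_bijective he b y t).sum_comp fun x =>
        if f x = C.eval x then (1 : ℝ) else 0, Finset.sum_boole]
    calc (Fintype.card Y : ℝ) * Fintype.card Z * A = ∑ y : Y, ∑ t : Z, A := by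
          simp [mul_assoc]
      _ = ∑ y : Y, ∑ t : Z, ∑ x, (if f (shiftInput he b x y t) =
            C.eval (shiftInput he b x y t) then (1 : ℝ) else 0) :=
          Finset.sum_congr rfl fun y _ => Finset.sum_congr rfl fun t _ => hA' y t
      _ = ∑ x, ∑ y : Y, ((Finset.univ.filter fun t : Z =>
            f (shiftInput he b x y t) = C.eval (shiftInput he b x y t)).card : ℝ) := by
          simp_rw [← Finset.sum_boole]
          rw [Finset.sum_comm]
          conv_rhs => rw [Finset.sum_comm]
          rw [Finset.sum_comm]
          exact Finset.sum_congr rfl fun y _ => Finset.sum_comm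
      _ ≤ ∑ x : Fin n → Bool, _ := Finset.sum_le_sum fun x _ => hpoint x
      _ = _ := by simp
  have hY : (Fintype.card Y : ℝ) = 2 ^ (n / 5) := by simp [Y]
  have hZ : (0 : ℝ) < Fintype.card Z := by exact_mod_cast Fintype.card_pos
  rw [hY] at hsum
  have h2 : (0 : ℝ) < 2 ^ (n / 5) := by positivity
  refine le_of_mul_le_mul_left (hsum.trans (le_of_eq ?_)) (mul_pos h2 hZ)
  field_simp

/-- A circuit that does not depend on all variables agrees with the parity on half of the
inputs. -/
theorem card_eq_parity (hC : C.touchedWires.card < n) :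
    ((Finset.univ.filter fun x : Fin n → Bool =>
      decide (((List.ofFn x).map toF2).sum = 1) = C.eval x).card : ℝ) = 2 ^ n / 2 := by
  classical
  obtain ⟨i, hi⟩ : ∃ i : Fin n, i ∉ C.touchedWires.image fun w => (C.label w).1 := by
    by_contra! h
    have h₁ := Finset.card_le_card fun i (_ : i ∈ Finset.univ) => h i
    rw [Finset.card_univ, Fintype.card_fin] at h₁
    exact absurd (h₁.trans Finset.card_image_le) (not_le.2 hC)
  -- Flipping an unread variable changes the parity but not the circuit, hence exchanges agreement
  -- and disagreement.
  let φ : (Fin n → Bool) → Fin n → Bool := fun x => Function.update x i (!x i)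
  have hφ : Function.Involutive φ := fun x => by simp [φ]
  have hpar : ∀ x : Fin n → Bool, ((List.ofFn (φ x)).map toF2).sum =
      ((List.ofFn x).map toF2).sum + 1 := fun x => by
    have hnot : ∀ b : Bool, toF2 (!b) = toF2 b + 1 := by decide
    simp only [List.map_ofFn, List.sum_ofFn, Function.comp_apply]
    rw [← Finset.add_sum_erase _ _ (Finset.mem_univ i),
      ← Finset.add_sum_erase Finset.univ (fun k => toF2 (x k)) (Finset.mem_univ i),
      Finset.sum_congr rfl fun k hk => by
        rw [show φ x k = x k from Function.update_of_ne (Finset.ne_of_mem_erase hk) _ _]]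
    simp only [φ, Function.update_self, hnot]
    ring
  have heval : ∀ x, C.eval (φ x) = C.eval x := fun x => C.eval_congr fun w hw =>
    Function.update_of_ne (fun h => hi (Finset.mem_image.2 ⟨w, hw, h⟩)) _ _
  have hflip : ∀ x : Fin n → Bool,
      (decide (((List.ofFn (φ x)).map toF2).sum = 1) = C.eval (φ x)) ↔
        ¬ (decide (((List.ofFn x).map toF2).sum = 1) = C.eval x) := fun x => by
    have h : ∀ (a : ZMod 2) (b : Bool), decide (a + 1 = 1) = b ↔ ¬ decide (a = 1) = b := by decide
    rw [hpar, heval, h]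
  have hcard : (Finset.univ.filter fun x : Fin n → Bool =>
        decide (((List.ofFn x).map toF2).sum = 1) = C.eval x).card =
      (Finset.univ.filter fun x : Fin n → Bool =>
        ¬ (decide (((List.ofFn x).map toF2).sum = 1) = C.eval x)).card := by
    refine Finset.card_bijective φ hφ.bijective fun x => ?_
    simp only [Finset.mem_filter, Finset.mem_univ, true_and, hflip, not_not]
  have htot := Finset.card_filter_add_card_filter_not (s := (Finset.univ : Finset (Fin n → Bool)))
    (fun x => decide (((List.ofFn x).map toF2).sum = 1) = C.eval x)
  rw [← hcard] at htot
  simp only [Finset.card_univ, Fintype.card_fun, Fintype.card_bool, Fintype.card_fin] at htot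
  rw [eq_div_iff two_ne_zero]
  exact_mod_cast (by omega : _ * 2 = 2 ^ n)

end LowerBound

end HardFunction

namespace HardFunction

/-! ### Parameters -/

theorem encodePosNum_length (p : PosNum) :
    (p : ℕ) < 2 ^ (Computability.encodePosNum p).length ∧
      2 ^ (Computability.encodePosNum p).length ≤ 2 * (p : ℕ) := by
  induction p with
  | one => simp [Computability.encodePosNum]
  | bit0 p ih =>
    simp only [Computability.encodePosNum, List.length_cons, pow_succ, PosNum.cast_bit0]
    omega
  | bit1 p ih =>
    simp only [Computability.encodePosNum, List.length_cons, pow_succ, PosNum.cast_bit1]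
    omega

/-- The code length `e` is thus within a factor two of `k`, yet depends only on the number of digits
of `k`, so the machine never looks at their values. -/
theorem encodeNat_length {k : ℕ} (hk : k ≠ 0) :
    k < 2 ^ (Computability.encodeNat k).length ∧
      2 ^ (Computability.encodeNat k).length ≤ 2 * k := by
  unfold Computability.encodeNat Computability.encodeNum
  cases h : (k : Num) with
  | zero =>
    have h' := Num.to_of_nat k
    rw [h] at h'
    exact absurd h'.symm hk
  | pos p =>
    have hp : (p : ℕ) = k := by
      rw [← Num.to_of_nat k, h]; rfl
    have := encodePosNum_length p
    rw [hp] at this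
    exact this

theorem two_rpow_logb {n : ℕ} (hn : 2 ≤ n) : (2 : ℝ) ^ Real.logb 2 n = n :=
  Real.rpow_logb (by norm_num) (by norm_num) (by positivity)

theorem one_le_logb {n : ℕ} (hn : 2 ≤ n) : 1 ≤ Real.logb 2 n := by
  rw [Real.le_logb_iff_rpow_le (by norm_num) (by positivity), Real.rpow_one]
  exact_mod_cast hn

/-- The error term of the averaging argument. -/
theorem code_error_le {n e k ℓ : ℕ} (hn : 2 ≤ n) (hk : 16 * Real.logb 2 n ≤ k) (hke : k < e)
    (hen : 32 * e ≤ n) (hℓ : (ℓ : ℝ) ^ 2 * Real.logb 2 n ≤ n / 128) :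
    (((ℓ ^ 2 + 1) ^ ℓ ^ 2 * (ℓ + 2) : ℕ) : ℝ) * (2 / ((2 : ℝ) ^ (-(e / 8 : ℝ))) ^ 2) /
      2 ^ (n / 5) ≤ (2 : ℝ) ^ (-(e / 8 : ℝ)) / 2 := by
  set g := Real.logb 2 n with hg
  have hg1 : 1 ≤ g := one_le_logb hn
  have hke' : (k : ℝ) + 1 ≤ e := by exact_mod_cast hke
  have hen' : 32 * (e : ℝ) ≤ n := by exact_mod_cast hen
  have hn512 : (512 : ℝ) ≤ n := by linarith
  have hℓsq : (ℓ : ℝ) ^ 2 ≤ n / 128 :=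
    (le_mul_of_one_le_right (by positivity) hg1).trans hℓ
  have h₁ : ((ℓ ^ 2 + 1 : ℕ) : ℝ) ≤ n := by push_cast; linarith
  have h₂ : ((ℓ + 2 : ℕ) : ℝ) ≤ n := by
    have : (ℓ : ℝ) ≤ (ℓ : ℝ) ^ 2 := by exact_mod_cast Nat.le_self_pow two_ne_zero ℓ
    push_cast; linarith
  have h₃ : (((ℓ ^ 2 + 1) ^ ℓ ^ 2 * (ℓ + 2) : ℕ) : ℝ) ≤ (2 : ℝ) ^ (n / 128 + g : ℝ) := by
    calc (((ℓ ^ 2 + 1) ^ ℓ ^ 2 * (ℓ + 2) : ℕ) : ℝ)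
        = ((ℓ ^ 2 + 1 : ℕ) : ℝ) ^ ℓ ^ 2 * ((ℓ + 2 : ℕ) : ℝ) := by push_cast; rfl
      _ ≤ (n : ℝ) ^ ℓ ^ 2 * n := by gcongr
      _ = (2 : ℝ) ^ ((ℓ : ℝ) ^ 2 * g + g) := by
          rw [Real.rpow_add two_pos, two_rpow_logb hn, mul_comm _ g, Real.rpow_mul two_pos.le,
            two_rpow_logb hn]
          congr 1
          rw [← Real.rpow_natCast]
          push_cast; rfl
      _ ≤ (2 : ℝ) ^ (n / 128 + g : ℝ) :=
          Real.rpow_le_rpow_of_exponent_le one_le_two (by linarith)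
  have h₄ : 2 / ((2 : ℝ) ^ (-(e / 8 : ℝ))) ^ 2 = (2 : ℝ) ^ (1 + e / 4 : ℝ) := by
    rw [← Real.rpow_natCast, ← Real.rpow_mul two_pos.le, Real.rpow_add two_pos, Real.rpow_one,
      div_eq_mul_inv, ← Real.rpow_neg two_pos.le]
    congr 2
    push_cast; ring
  have h₅ : (n : ℝ) / 5 - 1 ≤ ((n / 5 : ℕ) : ℝ) := by
    have : (n : ℝ) ≤ 5 * ((n / 5 : ℕ) : ℝ) + 4 := by
      exact_mod_cast (by omega : n ≤ 5 * (n / 5) + 4)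
    linarith
  rw [h₄]
  calc _ ≤ (2 : ℝ) ^ (n / 128 + g : ℝ) * (2 : ℝ) ^ (1 + e / 4 : ℝ) / 2 ^ (n / 5) := by gcongr
    _ = (2 : ℝ) ^ (n / 128 + g + (1 + e / 4) - (n / 5 : ℕ) : ℝ) := by
        rw [← Real.rpow_natCast, ← Real.rpow_add two_pos, ← Real.rpow_sub two_pos]
    _ ≤ (2 : ℝ) ^ (-(e / 8) - 1 : ℝ) :=
        Real.rpow_le_rpow_of_exponent_le one_le_two (by linarith)
    _ = _ := by rw [Real.rpow_sub two_pos, Real.rpow_one]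

/-- The relative distance of the code. -/
theorem code_bias_le {n e k : ℕ} (hn : 2 ≤ n) (hk : 16 * Real.logb 2 n ≤ k) (hke : k < e) :
    2 * ((n / 5 : ℕ) / 2 ^ e : ℝ) ≤ ((2 : ℝ) ^ (-(e / 8 : ℝ))) ^ 2 := by
  have hg1 := one_le_logb hn
  have hke' : (k : ℝ) + 1 ≤ e := by exact_mod_cast hke
  have h₁ : ((n / 5 : ℕ) : ℝ) ≤ (2 : ℝ) ^ Real.logb 2 n := by
    rw [two_rpow_logb hn]; exact_mod_cast Nat.div_le_self n 5
  calc 2 * ((n / 5 : ℕ) / 2 ^ e : ℝ) ≤ 2 * ((2 : ℝ) ^ Real.logb 2 n / 2 ^ e) := by gcongr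
    _ = (2 : ℝ) ^ (1 + Real.logb 2 n - e) := by
        rw [Real.rpow_sub two_pos, Real.rpow_add two_pos, Real.rpow_one, Real.rpow_natCast]
        ring
    _ ≤ (2 : ℝ) ^ (-(e / 8 : ℝ) * (2 : ℕ)) :=
        Real.rpow_le_rpow_of_exponent_le one_le_two (by push_cast; linarith)
    _ = _ := by rw [Real.rpow_mul two_pos.le, Real.rpow_natCast]

/-- The size of the circuits to which the average-case bound applies. -/
noncomputable def sizeBound (n k : ℕ) : ℝ :=
  (n : ℝ) ^ (3 / 2 : ℝ) / (1024 * k * √(Real.logb 2 n))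

theorem sizeBound_mul_eq {n k : ℕ} (hn : 2 ≤ n) (hk : k ≠ 0) :
    sizeBound n k * (1024 * k) * √(Real.logb 2 n) = n * √n := by
  have hk : (k : ℝ) ≠ 0 := by exact_mod_cast hk
  have hs : √(Real.logb 2 n) ≠ 0 :=
    (Real.sqrt_pos.2 (zero_lt_one.trans_le (one_le_logb hn))).ne'
  have hn0 : (0 : ℝ) < n := by positivity
  rw [sizeBound, show (3 / 2 : ℝ) = 1 + 1 / 2 by norm_num, Real.rpow_add hn0, Real.rpow_one,
    ← Real.sqrt_eq_rpow]
  field_simp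

theorem agreement_hardFn_le {n k : ℕ} (hn : 2 ≤ n) (hk : 16 * Real.logb 2 n ≤ k)
    (C : ComparatorCircuit n)
    (hC : (C.numWires : ℝ) ≤ sizeBound n k ∨ (C.numGates : ℝ) ≤ sizeBound n k) :
    C.agreement (onLength (hardFn k) n) ≤ 1 / 2 + (2 : ℝ) ^ (-(1 / 8 * k : ℝ)) := by
  set B := sizeBound n k with hB
  set g := Real.logb 2 n with hg
  have hg1 : 1 ≤ g := one_le_logb hn
  have hk16 : (16 : ℝ) ≤ k := by linarith
  have hk0 : k ≠ 0 := by rintro rfl; norm_num at hk16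
  have hB0 : 0 ≤ B := by rw [hB, sizeBound]; positivity
  have hBeq : B * (1024 * k) * √g = n * √n := sizeBound_mul_eq hn hk0
  have hR : (C.touchedWires.card : ℝ) ≤ 2 * B + 1 := by
    rcases hC with h | h
    · have : (C.touchedWires.card : ℝ) ≤ C.numWires := by
        exact_mod_cast C.card_touchedWires_le_numWires
      linarith
    · have : (C.touchedWires.card : ℝ) ≤ 2 * C.numGates + 1 := by
        exact_mod_cast C.card_touchedWires_le_numGates
      linarith
  have hsg : 1 ≤ √g := Real.one_le_sqrt.2 hg1
  have hnR : (2 : ℝ) ≤ n := by exact_mod_cast hn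
  have hsn : √n * √n = n := Real.mul_self_sqrt (by positivity)
  have hsn1 : 1 ≤ √(n : ℝ) := Real.one_le_sqrt.2 (by linarith)
  obtain ⟨hke, hek⟩ := encodeNat_length hk0
  set j := (Computability.encodeNat k).length with hj
  have hek' : ((2 ^ j : ℕ) : ℝ) ≤ 2 * k := by exact_mod_cast hek
  have hke' : (k : ℝ) ≤ ((2 ^ j : ℕ) : ℝ) := by exact_mod_cast hke.le
  rw [ComparatorCircuit.agreement, div_le_iff₀ (by positivity)]
  by_cases hcase : 32 * 2 ^ j ≤ n
  · have hfun : ∀ x : Fin n → Bool, onLength (hardFn k) n x =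
        decide (codeBit (message (List.ofFn x).reverse).reverse
          (selector (2 ^ j) (List.ofFn x).reverse) = 1) := fun x => by
      rw [onLength, hardFn, ← hj, List.length_ofFn, if_pos hcase]
    simp only [hfun]
    set e := 2 ^ j with he
    set q := n / 5 / e with hq
    have hepos : 0 < e := by positivity
    -- Rounding in the two divisions costs less than a factor two because `32 * e ≤ n`.
    have hqe : n ≤ 10 * (q * e) := by
      have h₁ : n / 5 < e * (n / 5 / e + 1) := Nat.lt_mul_div_succ _ hepos
      rw [← hq, mul_add, mul_comm e q] at h₁
      omega
    have hq4 : 3 < q := by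
      by_contra hlt
      have : q * e ≤ 3 * e := Nat.mul_le_mul_right e (not_lt.1 hlt)
      omega
    set ℓ := C.touchedWires.card / q with hℓ
    have hℓlt : C.touchedWires.card < q * (ℓ + 1) := Nat.lt_mul_div_succ _ (by omega)
    -- If `ℓ` is positive, then `4 ≤ ℓ * q ≤ 2 * B + 1`, so the summand `1` is at most `2 * B`.
    have hℓq : (ℓ : ℝ) * q ≤ 4 * B := by
      have h₁ : (ℓ : ℝ) * q ≤ 2 * B + 1 := by
        refine le_trans ?_ hR
        exact_mod_cast Nat.div_mul_le_self _ _
      rcases Nat.eq_zero_or_pos ℓ with h0 | h0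
      · rw [h0]; simpa using hB0
      · have h₂ : (4 : ℝ) ≤ q := by exact_mod_cast hq4
        have h₃ : (1 : ℝ) ≤ ℓ := by exact_mod_cast h0
        nlinarith
    have hqeR : (n : ℝ) ≤ 10 * (q * e) := by exact_mod_cast hqe
    have hℓB : (ℓ : ℝ) * n ≤ 80 * B * k := by
      calc (ℓ : ℝ) * n ≤ ℓ * (10 * (q * e)) := by gcongr
        _ = 10 * (ℓ * q) * e := by ring
        _ ≤ 10 * (4 * B) * (2 * k) := by gcongr
        _ = 80 * B * k := by ring
    have hℓs : (ℓ : ℝ) * √g ≤ √n / 12 := by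
      have h₁ : (n : ℝ) * (12 * (ℓ * √g)) ≤ n * √n := by
        rw [← hBeq]
        have : (0 : ℝ) ≤ B * k * √g := by positivity
        nlinarith [mul_le_mul_of_nonneg_right hℓB (zero_le_one.trans hsg)]
      have := le_of_mul_le_mul_left h₁ (by linarith)
      linarith
    have hℓsq : (ℓ : ℝ) ^ 2 * g ≤ n / 128 := by
      have h₁ : ((ℓ : ℝ) * √g) ^ 2 ≤ (√n / 12) ^ 2 := pow_le_pow_left₀ (by positivity) hℓs 2
      rw [mul_pow, Real.sq_sqrt (zero_le_one.trans hg1), div_pow,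
        Real.sq_sqrt (by positivity)] at h₁
      linarith
    have hmain := card_eq_code_le C (j := j) (ℓ := ℓ) (ε := (2 : ℝ) ^ (-((e : ℝ) / 8)))
      (by positivity) (code_bias_le hn hk hke) hℓlt
    refine hmain.trans ?_
    rw [mul_comm]
    refine mul_le_mul_of_nonneg_right ?_ (by positivity)
    -- Good messages exceed one half by `ε / 2`, and the bad ones contribute at most another `ε /
    -- 2`.
    have herr := code_error_le hn hk hke hcase hℓsq
    have hmono : (2 : ℝ) ^ (-((e : ℝ) / 8)) ≤ (2 : ℝ) ^ (-(1 / 8 * k : ℝ)) :=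
      Real.rpow_le_rpow_of_exponent_le one_le_two (by linarith)
    linarith
  · have hfun : ∀ x : Fin n → Bool, onLength (hardFn k) n x =
        decide (((List.ofFn x).map toF2).sum = 1) := fun x => by
      rw [onLength, hardFn, ← hj, List.length_ofFn, if_neg hcase]
    simp only [hfun]
    have hlt : (n : ℝ) ≤ 64 * k := by
      have h₁ : n ≤ 64 * k := by omega
      exact_mod_cast h₁
    -- With `n ≤ 64 * k` the size bound is at most `√n / 16`, so some variable is unread.
    have hRn : C.touchedWires.card < n := by
      have h₁ : 16 * B ≤ √n := by
        have h₂ : (n : ℝ) * (16 * B) ≤ n * √n := by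
          rw [← hBeq]
          have h₃ : (n : ℝ) * (16 * B) ≤ 64 * k * (16 * B) := by gcongr
          have h₄ : B * (1024 * k) ≤ B * (1024 * k) * √g :=
            le_mul_of_one_le_right (by positivity) hsg
          linarith
        exact le_of_mul_le_mul_left h₂ (by linarith)
      have h₅ : (C.touchedWires.card : ℝ) < n := by nlinarith
      exact_mod_cast h₅
    rw [card_eq_parity C hRn]
    have : (0 : ℝ) ≤ (2 : ℝ) ^ (-(1 / 8 * k : ℝ)) * 2 ^ n := by positivity
    linarith

/-- The worst-case bound that follows from the average-case bound. -/
theorem size_le_of_computes {n k : ℕ} {K : ℝ} (hn : 2 ≤ n) (hk : 16 * Real.logb 2 n ≤ k)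
    (hK : (k : ℝ) ≤ K * Real.logb 2 n) (C : ComparatorCircuit n)
    (hC : ∀ x, C.eval x = onLength (hardFn k) n x) :
    1 / (1024 * (|K| + 1)) * ((n : ℝ) / Real.logb 2 n) ^ (3 / 2 : ℝ) ≤ C.numWires ∧
      1 / (1024 * (|K| + 1)) * ((n : ℝ) / Real.logb 2 n) ^ (3 / 2 : ℝ) ≤ C.numGates := by
  set g := Real.logb 2 n with hg
  have hg1 : 1 ≤ g := one_le_logb hn
  have hk16 : (16 : ℝ) ≤ k := by linarith
  have hagree : C.agreement (onLength (hardFn k) n) = 1 := by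
    rw [ComparatorCircuit.agreement, Finset.filter_true_of_mem fun x _ => (hC x).symm]
    simp
  have hlarge : 1 / 2 + (2 : ℝ) ^ (-(1 / 8 * k : ℝ)) < 1 := by
    have : (2 : ℝ) ^ (-(1 / 8 * k : ℝ)) ≤ (2 : ℝ) ^ (-2 : ℝ) :=
      Real.rpow_le_rpow_of_exponent_le one_le_two (by linarith)
    have h4 : (2 : ℝ) ^ (-2 : ℝ) = 1 / 4 := by
      rw [Real.rpow_neg two_pos.le]; norm_num
    linarith
  have hbig : ¬ ((C.numWires : ℝ) ≤ sizeBound n k ∨ (C.numGates : ℝ) ≤ sizeBound n k) := fun h =>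
    absurd (agreement_hardFn_le hn hk C h) (by rw [hagree]; exact not_le.2 hlarge)
  push Not at hbig
  have hle : 1 / (1024 * (|K| + 1)) * ((n : ℝ) / g) ^ (3 / 2 : ℝ) ≤ sizeBound n k := by
    have hg0 : 0 < g := zero_lt_one.trans_le hg1
    have hgpow : g ^ (3 / 2 : ℝ) = g * √g := by
      rw [show (3 / 2 : ℝ) = 1 + 1 / 2 by norm_num, Real.rpow_add hg0, Real.rpow_one,
        ← Real.sqrt_eq_rpow]
    -- Using `|K| + 1` instead of `K` keeps the constant positive for every real `K`.
    have hkK : (k : ℝ) ≤ (|K| + 1) * g := by nlinarith [le_abs_self K]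
    rw [sizeBound, ← hg, Real.div_rpow (by positivity) hg0.le, hgpow, div_mul_div_comm, one_mul]
    have hs : 0 < √g := Real.sqrt_pos.2 hg0
    refine div_le_div_of_nonneg_left (by positivity) (by positivity) ?_
    calc 1024 * (k : ℝ) * √g ≤ 1024 * ((|K| + 1) * g) * √g := by gcongr
      _ = 1024 * (|K| + 1) * (g * √g) := by ring
  exact ⟨hle.trans hbig.1.le, hle.trans hbig.2.le⟩

end HardFunction

/-! ### A stack machine for the hard function -/

namespace HardFunction

namespace Machine

/-- The stacks of the machine. -/
inductive Stack
  | inp | out | dig | xs | cnt | cntTmp | siz | sizTmp | ys | zl | zr | v | vTmp | w | wTmp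
  deriving DecidableEq

instance : Fintype Stack where
  elems := {.inp, .out, .dig, .xs, .cnt, .cntTmp, .siz, .sizTmp, .ys, .zl, .zr, .v, .vTmp, .w,
    .wTmp}
  complete k := by cases k <;> decide

/-- The alphabets of the stacks. -/
abbrev Alphabet : Stack → Type
  | .inp => Bool ⊕ Bool
  | .out | .xs | .ys => Bool
  | .dig | .cnt | .cntTmp | .siz | .sizTmp => Unit
  | .zl | .zr => Slot
  | .v | .vTmp | .w | .wTmp => ZMod 5

/-- The registers of the machine. -/
structure Reg where
  /-- whether the last reading was successful -/
  ok : Bool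
  /-- whether the last input symbol was a digit of `k` -/
  isDigit : Bool
  /-- a bit of the input -/
  bit : Bool
  /-- an accumulator -/
  acc : ZMod 2
  /-- a selector symbol -/
  slot : Slot
  /-- the coefficient that is moved by a rotation -/
  carry : ZMod 5
  /-- a symbol -/
  sym : ZMod 5
  /-- a second symbol -/
  sym₂ : ZMod 5

noncomputable instance : Fintype Reg :=
  Fintype.ofInjective
    (fun r => (r.ok, r.isDigit, r.bit, r.acc, r.slot, r.carry, r.sym, r.sym₂)) fun r r' h => by
      cases r; cases r'; simpa using h

/-- The initial contents of the registers. -/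
def Reg.init : Reg := ⟨false, false, false, 0, 0, 0, 0, 0⟩

/-- The places from which the selector is moved back. -/
inductive PourReturn
  | split | horner | swap
  deriving DecidableEq

/-- The places from which the coefficients are moved back. -/
inductive BackReturn
  | mul | addConst
  deriving DecidableEq

/-- The labels of the machine. -/
inductive Label
  | read | digit | halve | pourCnt | testCnt | double | pourSiz | check | parity | init | split
  | pourSel (q : PourReturn)
  | horner | mul | rot | back (q : BackReturn) | swap | addConst | output | clean
  deriving DecidableEq

instance : Fintype Label where
  elems := {.read, .digit, .halve, .pourCnt, .testCnt, .double, .pourSiz, .check, .parity, .init,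
    .split, .pourSel .split, .pourSel .horner, .pourSel .swap, .horner, .mul, .rot, .back .mul,
    .back .addConst, .swap, .addConst, .output, .clean}
  complete l := by
    cases l with
    | pourSel q => cases q <;> decide
    | back q => cases q <;> decide
    | _ => decide

/-- The label at which the computation continues. -/
@[simp] def PourReturn.label : PourReturn → Label
  | .split => .split
  | .horner => .horner
  | .swap => .swap

/-- The label at which the computation continues. -/
@[simp] def BackReturn.label : BackReturn → Label
  | .mul => .mul
  | .addConst => .addConst

open Turing.TM2.Stmt

/-- The statements of the machine. -/
abbrev Statement := Turing.TM2.Stmt Alphabet Label Reg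

/-- Pop a symbol of an arbitrary stack and record the success. -/
@[simp] def popOk (k : Stack) (q : Statement) : Statement := pop k (fun r o => { r with ok := o.isSome }) q

/-- Pop a symbol, and continue with the first or the second statement according to the success. -/
@[simp] def popIf (k : Stack) (q q' : Statement) : Statement := popOk k (branch Reg.ok q q')

/-- Pop `n` symbols, and continue with the first or the second statement according to the
success. -/
@[simp] def popMany (k : Stack) : ℕ → Statement → Statement → Statement
  | 0, q, _ => q
  | n + 1, q, q' => popIf k (popMany k n q q') q'

/-- Jump to a label. -/
@[simp] def jump (l : Label) : Statement := goto fun _ => l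

/-- The program of the machine. -/
@[simp] def program : Label → Statement
  | .read => pop .inp (fun r o => { r with
        ok := o.isSome
        isDigit := (o.elim false Sum.isLeft)
        bit := (o.elim false (Sum.elim id id)) }) <|
      branch Reg.ok
        (branch Reg.isDigit (push .dig (fun _ => ()) (jump .read))
          (push .xs Reg.bit (push .cnt (fun _ => ()) (jump .read))))
        (push .siz (fun _ => ()) (jump .digit))
  | .digit => popIf .dig (jump .halve) (jump .check)
  | .halve => popIf .cnt (popIf .cnt (push .cntTmp (fun _ => ()) (jump .halve)) (jump .pourCnt))
      (jump .pourCnt)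
  | .pourCnt => popIf .cntTmp (push .cnt (fun _ => ()) (jump .pourCnt)) (jump .testCnt)
  | .testCnt => peek .cnt (fun r o => { r with ok := o.isSome }) <|
      branch Reg.ok (jump .double) (jump .digit)
  | .double => popIf .siz (push .sizTmp (fun _ => ()) (push .sizTmp (fun _ => ()) (jump .double)))
      (jump .pourSiz)
  | .pourSiz => popIf .sizTmp (push .siz (fun _ => ()) (jump .pourSiz)) (jump .digit)
  | .check => popMany .cnt 32 (jump .init) (jump .parity)
  | .parity => pop .xs (fun r o => { r with
        ok := o.isSome
        acc := r.acc + o.elim 0 toF2 }) <|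
      branch Reg.ok (jump .parity) (jump .clean)
  | .init => popIf .siz
      (push .zr (fun _ => 0) (push .v (fun _ => 0) (push .w (fun _ => 0) (jump .init))))
      (jump .split)
  | .split => peek .zr (fun r o => { r with ok := o.isSome }) <|
      branch Reg.ok
        (pop .xs (fun r o => { r with ok := o.isSome, bit := o.getD false }) <|
        pop .xs (fun r o => { r with
          ok := r.ok && o.isSome, slot := (toF2 (o.getD false), r.slot.2) }) <|
        pop .xs (fun r o => { r with
          ok := r.ok && o.isSome
          slot := (r.slot.1, Function.update r.slot.2 0 (toF2 (o.getD false))) }) <|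
        pop .xs (fun r o => { r with
          ok := r.ok && o.isSome
          slot := (r.slot.1, Function.update r.slot.2 1 (toF2 (o.getD false))) }) <|
        pop .xs (fun r o => { r with
          ok := r.ok && o.isSome
          slot := (r.slot.1, Function.update r.slot.2 2 (toF2 (o.getD false))) }) <|
        branch Reg.ok
          (pop .zr (fun r o => { r with slot := o.getD 0 + r.slot }) <|
            push .zl Reg.slot <| push .ys Reg.bit <| jump .split)
          (jump (.pourSel .horner)))
        (jump (.pourSel .split))
  | .pourSel q => pop .zl (fun r o => { r with ok := o.isSome, slot := o.getD 0 }) <|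
      branch Reg.ok (push .zr Reg.slot (jump (.pourSel q))) (jump q.label)
  | .horner => pop .ys (fun r o => { r with ok := o.isSome, bit := o.getD false }) <|
      branch Reg.ok (jump .mul) (jump .output)
  | .mul => pop .zr (fun r o => { r with ok := o.isSome, slot := o.getD 0 }) <|
      branch Reg.ok
        (push .zl Reg.slot <| pop .w (fun r o => { r with carry := 3 * o.getD 0 }) <| jump .rot)
        (jump (.pourSel .swap))
  | .rot => pop .v (fun r o => { r with ok := o.isSome, sym := o.getD 0 }) <|
      branch Reg.ok
        (push .vTmp Reg.sym <| pop .w (fun r o => { r with sym₂ := o.getD r.carry }) <|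
          push .wTmp (fun r => r.sym₂ + emb r.slot.1 * r.sym) <| jump .rot)
        (jump (.back .mul))
  | .back q => pop .vTmp (fun r o => { r with ok := o.isSome, sym := o.getD 0 }) <|
      branch Reg.ok
        (push .v Reg.sym <| pop .wTmp (fun r o => { r with sym₂ := o.getD 0 }) <|
          push .w Reg.sym₂ <| jump (.back q))
        (jump q.label)
  | .swap => pop .w (fun r o => { r with ok := o.isSome, sym := o.getD 0 }) <|
      branch Reg.ok
        (push .vTmp Reg.sym <| pop .v (fun r _ => r) <| push .wTmp (fun _ => 0) <| jump .swap)
        (jump (.back .addConst))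
  | .addConst => pop .v (fun r o => { r with sym := o.getD 0 }) <|
      push .v (fun r => r.sym + toF5 r.bit) <| jump .horner
  | .output => pop .v (fun r o => { r with ok := o.isSome, sym := o.getD 0 }) <|
      branch Reg.ok
        (pop .zr (fun r o => { r with acc := r.acc + testSymbol r.sym (o.getD 0) }) <|
          jump .output)
        (jump .clean)
  | .clean => pop .cnt (fun r o => { r with ok := o.isSome }) <|
      pop .siz (fun r o => { r with ok := r.ok || o.isSome }) <|
      pop .w (fun r o => { r with ok := r.ok || o.isSome }) <|
      branch Reg.ok (jump .clean)
        (push .out (fun r => decide (r.acc = 1)) <| load (fun _ => Reg.init) halt)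

/-- The contents of the stacks. -/
structure Mem where
  inp : List (Bool ⊕ Bool) := []
  out : List Bool := []
  dig : List Unit := []
  xs : List Bool := []
  cnt : List Unit := []
  cntTmp : List Unit := []
  siz : List Unit := []
  sizTmp : List Unit := []
  ys : List Bool := []
  zl : List Slot := []
  zr : List Slot := []
  v : List (ZMod 5) := []
  vTmp : List (ZMod 5) := []
  w : List (ZMod 5) := []
  wTmp : List (ZMod 5) := []

/-- The contents of the stacks as a dependent function. -/
def Mem.stk (m : Mem) : ∀ k, List (Alphabet k)
  | .inp => m.inp
  | .out => m.out
  | .dig => m.dig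
  | .xs => m.xs
  | .cnt => m.cnt
  | .cntTmp => m.cntTmp
  | .siz => m.siz
  | .sizTmp => m.sizTmp
  | .ys => m.ys
  | .zl => m.zl
  | .zr => m.zr
  | .v => m.v
  | .vTmp => m.vTmp
  | .w => m.w
  | .wTmp => m.wTmp

/-! ### Reading and updating the record of stacks. -/

section Stk

variable (m : Mem)

@[simp] theorem stk_inp : m.stk .inp = m.inp := rfl
@[simp] theorem stk_out : m.stk .out = m.out := rfl
@[simp] theorem stk_dig : m.stk .dig = m.dig := rfl
@[simp] theorem stk_xs : m.stk .xs = m.xs := rfl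
@[simp] theorem stk_cnt : m.stk .cnt = m.cnt := rfl
@[simp] theorem stk_cntTmp : m.stk .cntTmp = m.cntTmp := rfl
@[simp] theorem stk_siz : m.stk .siz = m.siz := rfl
@[simp] theorem stk_sizTmp : m.stk .sizTmp = m.sizTmp := rfl
@[simp] theorem stk_ys : m.stk .ys = m.ys := rfl
@[simp] theorem stk_zl : m.stk .zl = m.zl := rfl
@[simp] theorem stk_zr : m.stk .zr = m.zr := rfl
@[simp] theorem stk_v : m.stk .v = m.v := rfl
@[simp] theorem stk_vTmp : m.stk .vTmp = m.vTmp := rfl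
@[simp] theorem stk_w : m.stk .w = m.w := rfl
@[simp] theorem stk_wTmp : m.stk .wTmp = m.wTmp := rfl

end Stk

section Update

variable (m : Mem)

@[simp] theorem update_inp (l) : Function.update m.stk .inp l = { m with inp := l }.stk := by
  funext k; cases k <;> rfl
@[simp] theorem update_out (l) : Function.update m.stk .out l = { m with out := l }.stk := by
  funext k; cases k <;> rfl
@[simp] theorem update_dig (l) : Function.update m.stk .dig l = { m with dig := l }.stk := by
  funext k; cases k <;> rfl
@[simp] theorem update_xs (l) : Function.update m.stk .xs l = { m with xs := l }.stk := by
  funext k; cases k <;> rfl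
@[simp] theorem update_cnt (l) : Function.update m.stk .cnt l = { m with cnt := l }.stk := by
  funext k; cases k <;> rfl
@[simp] theorem update_cntTmp (l) :
    Function.update m.stk .cntTmp l = { m with cntTmp := l }.stk := by
  funext k; cases k <;> rfl
@[simp] theorem update_siz (l) : Function.update m.stk .siz l = { m with siz := l }.stk := by
  funext k; cases k <;> rfl
@[simp] theorem update_sizTmp (l) :
    Function.update m.stk .sizTmp l = { m with sizTmp := l }.stk := by
  funext k; cases k <;> rfl
@[simp] theorem update_ys (l) : Function.update m.stk .ys l = { m with ys := l }.stk := by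
  funext k; cases k <;> rfl
@[simp] theorem update_zl (l) : Function.update m.stk .zl l = { m with zl := l }.stk := by
  funext k; cases k <;> rfl
@[simp] theorem update_zr (l) : Function.update m.stk .zr l = { m with zr := l }.stk := by
  funext k; cases k <;> rfl
@[simp] theorem update_v (l) : Function.update m.stk .v l = { m with v := l }.stk := by
  funext k; cases k <;> rfl
@[simp] theorem update_vTmp (l) : Function.update m.stk .vTmp l = { m with vTmp := l }.stk := by
  funext k; cases k <;> rfl
@[simp] theorem update_w (l) : Function.update m.stk .w l = { m with w := l }.stk := by
  funext k; cases k <;> rfl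
@[simp] theorem update_wTmp (l) : Function.update m.stk .wTmp l = { m with wTmp := l }.stk := by
  funext k; cases k <;> rfl

end Update

/-! ### Reachability with a bound on the number of steps. -/

/-- The configuration of the machine at a label. -/
def cfg (l : Label) (r : Reg) (m : Mem) : Turing.TM2.Cfg Alphabet Label Reg := ⟨some l, r, m.stk⟩

/-- Reachability in a bounded number of steps. -/
def Steps (n : ℕ) (c c' : Turing.TM2.Cfg Alphabet Label Reg) : Prop :=
  ∃ k ≤ n, (flip bind (Turing.TM2.step program))^[k] (some c) = some c'

theorem Steps.refl (n : ℕ) (c) : Steps n c c := ⟨0, Nat.zero_le n, rfl⟩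

theorem Steps.trans {n n' : ℕ} {a b c} (h : Steps n a b) (h' : Steps n' b c) :
    Steps (n + n') a c := by
  obtain ⟨k, hk, e⟩ := h
  obtain ⟨k', hk', e'⟩ := h'
  exact ⟨k' + k, by omega, by rw [Function.iterate_add_apply, e, e']⟩

theorem Steps.mono {n n' : ℕ} {a b} (h : Steps n a b) (hn : n ≤ n') : Steps n' a b := by
  obtain ⟨k, hk, e⟩ := h
  exact ⟨k, hk.trans hn, e⟩

/-- The configuration after one step. -/
@[simp] def next (l : Label) (r : Reg) (m : Mem) : Turing.TM2.Cfg Alphabet Label Reg :=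
  Turing.TM2.stepAux (program l) r m.stk

theorem Steps.single (l r m) : Steps 1 (cfg l r m) (next l r m) := ⟨1, le_rfl, rfl⟩

theorem Steps.head {n : ℕ} {l r m c} (h : Steps n (next l r m) c) : Steps (n + 1) (cfg l r m) c :=
  ((Steps.single l r m).trans h).mono (by omega)

/-- Reachability of a label with given contents of the stacks and a property of the registers. -/
def Run (n : ℕ) (c : Turing.TM2.Cfg Alphabet Label Reg) (l : Label) (m : Mem) (P : Reg → Prop) :
    Prop := ∃ r, Steps n c (cfg l r m) ∧ P r

theorem Run.refl {n : ℕ} {l r m} {P : Reg → Prop} (h : P r) : Run n (cfg l r m) l m P :=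
  ⟨r, .refl _ _, h⟩

theorem Run.head {n : ℕ} {l r m l' m'} {P : Reg → Prop} (h : Run n (next l r m) l' m' P) :
    Run (n + 1) (cfg l r m) l' m' P :=
  h.imp fun _ h => ⟨h.1.head, h.2⟩

theorem Run.mono {n n' : ℕ} {c l m} {P Q : Reg → Prop} (h : Run n c l m P) (hn : n ≤ n')
    (hPQ : ∀ r, P r → Q r) : Run n' c l m Q :=
  h.imp fun r h => ⟨h.1.mono hn, hPQ r h.2⟩

theorem Run.trans {n n' : ℕ} {c l m l' m'} {P Q : Reg → Prop} (h : Run n c l m P)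
    (h' : ∀ r, P r → Run n' (cfg l r m) l' m' Q) : Run (n + n') c l' m' Q := by
  obtain ⟨r, h, hP⟩ := h
  obtain ⟨r', h', hQ⟩ := h' r hP
  exact ⟨r', h.trans h', hQ⟩

/-! #### The loops -/

theorem run_read_digits (D : List Bool) (rest : List (Bool ⊕ Bool)) (a : ℕ) (r : Reg) (m : Mem) :
    Run D.length
      (cfg .read r { m with inp := D.map Sum.inl ++ rest, dig := List.replicate a () })
      .read { m with inp := rest, dig := List.replicate (D.length + a) () }
      fun r' => r'.acc = r.acc := by
  induction D generalizing a r with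
  | nil => rw [List.length_nil, zero_add]; exact .refl rfl
  | cons d D ih =>
    refine .head ?_
    rw [List.length_cons, add_assoc, add_comm 1]
    simp
    exact ih (a + 1) _

theorem run_read_bits (x xs : List Bool) (a : ℕ) (r : Reg) (m : Mem) :
    Run (x.length + 1)
      (cfg .read r { m with inp := x.map Sum.inr, xs := xs, cnt := List.replicate a () })
      .digit { m with inp := [], xs := x.reverse ++ xs, cnt := List.replicate (x.length + a) (),
                      siz := () :: m.siz }
      fun r' => r'.acc = r.acc := by
  induction x generalizing a xs r with
  | nil =>
    refine .head ?_
    simp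
    exact .refl rfl
  | cons b x ih =>
    refine .head ?_
    rw [List.length_cons, add_assoc, add_comm 1]
    simp
    exact ih (b :: xs) (a + 1) _

theorem run_pourCnt (a b : ℕ) (r : Reg) (m : Mem) :
    Run (a + 1)
      (cfg .pourCnt r { m with cntTmp := List.replicate a (), cnt := List.replicate b () })
      .testCnt { m with cntTmp := [], cnt := List.replicate (a + b) () }
      fun r' => r'.acc = r.acc := by
  induction a generalizing b r with
  | zero =>
    refine .head ?_
    simp
    exact .refl rfl
  | succ a ih =>
    refine .head ?_
    rw [add_assoc a, add_comm 1]
    simp [List.replicate_succ]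
    exact ih (b + 1) _

theorem run_pourSiz (a b : ℕ) (r : Reg) (m : Mem) :
    Run (a + 1)
      (cfg .pourSiz r { m with sizTmp := List.replicate a (), siz := List.replicate b () })
      .digit { m with sizTmp := [], siz := List.replicate (a + b) () }
      fun r' => r'.acc = r.acc := by
  induction a generalizing b r with
  | zero =>
    refine .head ?_
    simp
    exact .refl rfl
  | succ a ih =>
    refine .head ?_
    rw [add_assoc a, add_comm 1]
    simp [List.replicate_succ]
    exact ih (b + 1) _

theorem run_halve (a b : ℕ) (r : Reg) (m : Mem) :
    Run (a + 1)
      (cfg .halve r { m with cnt := List.replicate a (), cntTmp := List.replicate b () })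
      .pourCnt { m with cnt := [], cntTmp := List.replicate (a / 2 + b) () }
      fun r' => r'.acc = r.acc := by
  induction a using Nat.twoStepInduction generalizing b r with
  | zero =>
    refine .head ?_
    simp
    exact .refl rfl
  | one =>
    refine .head ?_
    simp
    exact .refl rfl
  | more a ih _ =>
    refine .head ?_
    rw [Nat.add_div_right a two_pos, Nat.succ_add_eq_add_succ]
    simp [List.replicate_succ]
    exact (ih (b + 1) _).mono (by omega) fun _ h => h

theorem run_double (a b : ℕ) (r : Reg) (m : Mem) :
    Run (a + 1)
      (cfg .double r { m with siz := List.replicate a (), sizTmp := List.replicate b () })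
      .pourSiz { m with siz := [], sizTmp := List.replicate (2 * a + b) () }
      fun r' => r'.acc = r.acc := by
  induction a generalizing b r with
  | zero =>
    refine .head ?_
    simp
    exact .refl rfl
  | succ a ih =>
    refine .head ?_
    rw [show 2 * (a + 1) + b = 2 * a + (b + 2) by ring]
    simp [List.replicate_succ]
    exact ih (b + 2) _

theorem run_init (a b : ℕ) (r : Reg) (m : Mem) :
    Run (a + 1)
      (cfg .init r { m with siz := List.replicate a (), zr := List.replicate b 0,
                            v := List.replicate b 0, w := List.replicate b 0 })
      .split { m with siz := [], zr := List.replicate (a + b) 0, v := List.replicate (a + b) 0,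
                      w := List.replicate (a + b) 0 }
      fun r' => r'.acc = r.acc := by
  induction a generalizing b r with
  | zero =>
    refine .head ?_
    simp
    exact .refl rfl
  | succ a ih =>
    refine .head ?_
    rw [add_assoc a, add_comm 1]
    simp [List.replicate_succ]
    exact ih (b + 1) _

theorem run_parity (x : List Bool) (r : Reg) (m : Mem) :
    Run (x.length + 1) (cfg .parity r { m with xs := x }) .clean { m with xs := [] }
      fun r' => r'.acc = r.acc + (x.map toF2).sum := by
  induction x generalizing r with
  | nil =>
    refine .head ?_
    simp
    exact .refl rfl
  | cons b x ih =>
    refine .head ?_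
    simp
    refine (ih _).mono le_rfl fun r' h => ?_
    rw [h, add_assoc]

theorem run_pourSel (q : PourReturn) (l l' : List Slot) (r : Reg) (m : Mem) :
    Run (l.length + 1) (cfg (.pourSel q) r { m with zl := l, zr := l' })
      q.label { m with zl := [], zr := l.reverse ++ l' }
      fun r' => r'.acc = r.acc ∧ r'.bit = r.bit := by
  induction l generalizing l' r with
  | nil =>
    refine .head ?_
    simp
    exact .refl ⟨rfl, rfl⟩
  | cons s l ih =>
    refine .head ?_
    simp
    exact ih (s :: l') _

theorem run_back (q : BackReturn) (A B V W : List (ZMod 5)) (h : A.length = B.length) (r : Reg)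
    (m : Mem) :
    Run (A.length + 1) (cfg (.back q) r { m with v := V, vTmp := A, w := W, wTmp := B })
      q.label { m with v := A.reverse ++ V, vTmp := [], w := B.reverse ++ W, wTmp := [] }
      fun r' => r'.acc = r.acc ∧ r'.bit = r.bit := by
  induction A generalizing B V W r with
  | nil =>
    obtain rfl := List.length_eq_zero_iff.1 h.symm
    refine .head ?_
    simp
    exact .refl ⟨rfl, rfl⟩
  | cons a A ih =>
    obtain _ | ⟨b, B⟩ := B
    · simp at h
    refine .head ?_
    simp
    exact ih B (a :: V) (b :: W) (by simpa using h) _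

/-- The head of `w` has already been popped into `carry`, so `w` runs out one symbol before `v`. The
default value of that last pop supplies the rotated coefficient. -/
theorem run_rot (vs ws A B : List (ZMod 5)) (h : vs.length = ws.length + 1) (r : Reg) (m : Mem) :
    Run (vs.length + 1) (cfg .rot r { m with v := vs, vTmp := A, w := ws, wTmp := B })
      (.back .mul) { m with
        v := [], vTmp := vs.reverse ++ A, w := []
        wTmp := (List.zipWith (fun p q => q + emb r.slot.1 * p) vs
          (ws ++ [r.carry])).reverse ++ B }
      fun r' => r'.acc = r.acc ∧ r'.bit = r.bit := by
  induction vs generalizing ws A B r with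
  | nil => simp at h
  | cons p vs ih =>
    obtain _ | ⟨q, ws⟩ := ws
    · obtain rfl : vs = [] := by simpa using h
      refine .head ?_
      simp
      refine Run.head (n := 0) (l := .rot) ?_
      simp
      exact .refl ⟨rfl, rfl⟩
    · refine .head ?_
      simp
      exact ih ws (p :: A) (_ :: B) (by simpa using h) _

/-- The product held in `w` is to become the new `v`, with `w` reset to zeros. The reversal is
undone by the following `back` loop. -/
theorem run_swap (vs ws A B : List (ZMod 5)) (h : vs.length = ws.length) (r : Reg) (m : Mem) :
    Run (ws.length + 1) (cfg .swap r { m with v := vs, vTmp := A, w := ws, wTmp := B })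
      (.back .addConst) { m with
        v := [], vTmp := ws.reverse ++ A, w := [], wTmp := List.replicate ws.length 0 ++ B }
      fun r' => r'.acc = r.acc ∧ r'.bit = r.bit := by
  induction ws generalizing vs A B r with
  | nil =>
    obtain rfl := List.length_eq_zero_iff.1 h
    refine .head ?_
    simp
    exact .refl ⟨rfl, rfl⟩
  | cons q ws ih =>
    obtain _ | ⟨p, vs⟩ := vs
    · simp at h
    refine .head ?_
    rw [List.length_cons, List.replicate_succ', List.append_assoc]
    simp
    exact ih vs (q :: A) (0 :: B) (by simpa using h) _

theorem run_output (vs : List (ZMod 5)) (z : List Slot) (h : vs.length = z.length) (r : Reg)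
    (m : Mem) :
    Run (vs.length + 1) (cfg .output r { m with v := vs, zr := z })
      .clean { m with v := [], zr := [] }
      fun r' => r'.acc = r.acc + (List.zipWith testSymbol vs z).sum := by
  induction vs generalizing z r with
  | nil =>
    obtain rfl := List.length_eq_zero_iff.1 h.symm
    refine .head ?_
    simp
    exact .refl rfl
  | cons p vs ih =>
    obtain _ | ⟨s, z⟩ := z
    · simp at h
    refine .head ?_
    simp
    refine (ih z (by simpa using h) _).mono le_rfl fun r' h => ?_
    rw [h, add_assoc]

theorem run_mul_step (s : Slot) (zl zr : List Slot) (v w : List (ZMod 5)) (h : v.length = w.length)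
    (hw : w ≠ []) (r : Reg) (m : Mem) :
    Run (2 * v.length + 3)
      (cfg .mul r { m with zl := zl, zr := s :: zr, v := v, vTmp := [], w := w, wTmp := [] })
      .mul { m with zl := s :: zl, zr := zr, v := v, vTmp := [], w := rotateAdd s.1 v w,
                    wTmp := [] }
      fun r' => r'.acc = r.acc ∧ r'.bit = r.bit := by
  obtain _ | ⟨c, w⟩ := w
  · exact absurd rfl hw
  refine Run.mono (n := (v.length + 1 + (v.length + 1)) + 1) (.head ?_) (by omega) fun _ h => h
  simp
  refine (run_rot v w [] [] (by simpa using h) _ { m with zl := s :: zl, zr := zr }).trans fun r₁ h₁ => ?_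
  have hlen : (List.zipWith (fun p q => q + emb s.1 * p) v (w ++ [3 * c])).length = v.length := by
    simpa using h.le
  have hb := run_back .mul v.reverse
    (List.zipWith (fun p q => q + emb s.1 * p) v (w ++ [3 * c])).reverse [] []
    (by simp only [List.length_reverse, hlen]) r₁ { m with zl := s :: zl, zr := zr }
  simp only [List.reverse_reverse, List.append_nil, List.length_reverse] at hb ⊢
  exact hb.mono le_rfl fun r₂ h₂ => ⟨h₂.1.trans h₁.1, h₂.2.trans h₁.2⟩

theorem run_mul (zl zr : List Slot) (v w : List (ZMod 5)) (h : v.length = w.length)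
    (hw : w ≠ []) (r : Reg) (m : Mem) :
    Run (zr.length * (2 * v.length + 3) + 1)
      (cfg .mul r { m with zl := zl, zr := zr, v := v, vTmp := [], w := w, wTmp := [] })
      (.pourSel .swap) { m with
        zl := zr.reverse ++ zl, zr := [], v := v, vTmp := []
        w := (zr.map Prod.fst).foldl (fun w a => rotateAdd a v w) w, wTmp := [] }
      fun r' => r'.acc = r.acc ∧ r'.bit = r.bit := by
  induction zr generalizing zl w r with
  | nil =>
    refine Run.mono (n := 1) (.head ?_) (by simp) fun _ h => h
    simp
    exact .refl ⟨rfl, rfl⟩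
  | cons s zr ih =>
    have hl := length_rotateAdd s.1 h.symm
    have hne : rotateAdd s.1 v w ≠ [] := by
      rw [← List.length_pos_iff, hl, h, List.length_pos_iff]; exact hw
    rw [List.reverse_cons, List.append_assoc, List.singleton_append, List.map_cons,
      List.foldl_cons]
    refine ((run_mul_step s zl zr v w h hw r m).trans fun r₁ h₁ =>
      (ih (s :: zl) (rotateAdd s.1 v w) hl.symm hne r₁).mono le_rfl fun r₂ h₂ =>
        (⟨h₂.1.trans h₁.1, h₂.2.trans h₁.2⟩ : r₂.acc = r.acc ∧ r₂.bit = r.bit)).mono ?_ fun _ h => h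
    rw [List.length_cons]
    nlinarith

theorem run_horner_step (b : Bool) (ys : List Bool) (z : List Slot) (v : List (ZMod 5))
    (hv : v.length = z.length) (hz : z ≠ []) (r : Reg) (m : Mem) :
    Run (2 * (z.length + 2) ^ 2)
      (cfg .horner r { m with ys := b :: ys, zl := [], zr := z, v := v, vTmp := []
                              w := List.replicate v.length 0, wTmp := [] })
      .horner { m with ys := ys, zl := [], zr := z, v := addConst b (mulBy (z.map Prod.fst) v)
                       vTmp := [], w := List.replicate v.length 0, wTmp := [] }
      fun r' => r'.acc = r.acc := by
  have hzpos := List.length_pos_iff.2 hz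
  have hne : List.replicate v.length (0 : ZMod 5) ≠ [] := by
    rw [← List.length_pos_iff, List.length_replicate]; omega
  have hml : (mulBy (z.map Prod.fst) v).length = v.length := length_mulBy _ _
  refine Run.mono (n := ((z.length * (2 * v.length + 3) + 1) + ((z.length + 1) +
    ((v.length + 1) + ((v.length + 1) + 1)))) + 1) (.head ?_) (by rw [hv]; nlinarith) fun _ h => h
  simp
  refine (run_mul [] z v _ (by simp) hne _ { m with ys := ys }).trans fun r₁ h₁ => ?_
  have hp := run_pourSel .swap (z.reverse ++ []) [] r₁ { m with
    ys := ys, v := v, vTmp := [], w := mulBy (z.map Prod.fst) v, wTmp := [] }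
  simp only [List.append_nil, List.reverse_reverse, List.length_reverse] at hp ⊢
  refine hp.trans fun r₂ h₂ => ?_
  have hs := run_swap v (mulBy (z.map Prod.fst) v) [] [] hml.symm r₂ { m with
    ys := ys, zl := [], zr := z }
  rw [hml] at hs
  refine hs.trans fun r₃ h₃ => ?_
  have hb := run_back .addConst ((mulBy (z.map Prod.fst) v).reverse ++ [])
    (List.replicate v.length 0 ++ []) [] [] (by simp [hml]) r₃ { m with
    ys := ys, zl := [], zr := z }
  simp only [List.append_nil, List.reverse_reverse, List.length_reverse, hml,
    List.reverse_replicate] at hb ⊢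
  refine hb.trans fun r₄ h₄ => ?_
  obtain ⟨c, t, hct⟩ := List.exists_cons_of_length_pos
    (show 0 < (mulBy (z.map Prod.fst) v).length by omega)
  rw [hct]
  refine .head ?_
  simp [addConst]
  rw [h₄.2, h₃.2, h₂.2, h₁.2]
  exact .refl (by rw [← h₁.1, ← h₂.1, ← h₃.1, ← h₄.1])

theorem run_horner (ys : List Bool) (z : List Slot) (v : List (ZMod 5))
    (hv : v.length = z.length) (hz : z ≠ []) (r : Reg) (m : Mem) :
    Run (ys.length * (2 * (z.length + 2) ^ 2) + 1)
      (cfg .horner r { m with ys := ys, zl := [], zr := z, v := v, vTmp := []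
                              w := List.replicate v.length 0, wTmp := [] })
      .output { m with ys := [], zl := [], zr := z
                       v := ys.foldl (fun v b => HardFunction.addConst b
                         (mulBy (z.map Prod.fst) v)) v
                       vTmp := [], w := List.replicate v.length 0, wTmp := [] }
      fun r' => r'.acc = r.acc := by
  induction ys generalizing v r with
  | nil =>
    refine Run.mono (n := 1) (.head ?_) (by simp) fun _ h => h
    simp
    exact .refl rfl
  | cons b ys ih =>
    have hl : (HardFunction.addConst b (mulBy (z.map Prod.fst) v)).length = v.length := by
      rw [length_addConst, length_mulBy]
    have h₂ := ih (HardFunction.addConst b (mulBy (z.map Prod.fst) v)) (hl.trans hv)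
    rw [hl] at h₂
    rw [List.foldl_cons]
    refine ((run_horner_step b ys z v hv hz r m).trans fun r₁ h₁ =>
      (h₂ r₁).mono le_rfl fun r₂ h₂ => h₂.trans h₁).mono ?_ fun _ h => h
    rw [List.length_cons]
    linarith

/-! #### The parameters -/

/-- `siz` is doubled only while the halved counter is nonzero. Unconditional doubling would reach `2
^ L` for `L` digits, which is exponential in the input length. -/
theorem run_digit (E a : ℕ) (d : List Unit) (r : Reg) (m : Mem) :
    Run (a + 1 + (a / 2 + 1) + 3 * E + 4)
      (cfg .digit r { m with dig := () :: d, cnt := List.replicate a (), cntTmp := []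
                             siz := List.replicate E (), sizTmp := [] })
      .digit { m with dig := d, cnt := List.replicate (a / 2) (), cntTmp := []
                      siz := List.replicate (if a / 2 = 0 then E else 2 * E) (), sizTmp := [] }
      fun r' => r'.acc = r.acc := by
  have hh := run_halve a 0
  have hp := run_pourCnt (a / 2) 0
  simp only [List.replicate_zero, add_zero] at hh hp
  generalize a / 2 = b at hh hp ⊢
  refine Run.mono (n := ((a + 1) + ((b + 1) + ((E + 1 + (2 * E + 1)) + 1))) + 1) (.head ?_)
    (by omega) fun _ h => h
  simp
  refine (hh _ { m with dig := d, siz := List.replicate E (), sizTmp := [] }).trans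
    fun r₁ h₁ => ?_
  refine (hp r₁ { m with dig := d, siz := List.replicate E (), sizTmp := [] }).trans
    fun r₂ h₂ => ?_
  refine .head ?_
  cases b with
  | zero =>
    simp
    exact .refl (h₂.trans h₁)
  | succ b =>
    rw [if_neg (Nat.succ_ne_zero b)]
    simp [List.replicate_succ]
    have hd := run_double E 0
    have hs := run_pourSiz (2 * E) 0
    simp only [List.replicate_zero, add_zero] at hd hs
    refine (hd _ { m with dig := d, cnt := () :: List.replicate b (), cntTmp := [] }).trans
      fun r₃ h₃ => ?_
    refine (hs r₃ { m with dig := d, cnt := () :: List.replicate b (), cntTmp := [] }).mono le_rfl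
      fun r₄ h₄ => ?_
    exact h₄.trans (h₃.trans (h₂.trans h₁))

theorem run_digits (N : ℕ) (L i E : ℕ) (hE : E ≤ N + 1) (hE' : N / 2 ^ i ≠ 0 → E = 2 ^ i)
    (r : Reg) (m : Mem) :
    ∃ E' ≤ N + 1, (N / 2 ^ (i + L) ≠ 0 → E' = 2 ^ (i + L)) ∧
      Run (L * (5 * N + 9) + 1)
        (cfg .digit r { m with dig := List.replicate L (), cnt := List.replicate (N / 2 ^ i) ()
                               cntTmp := [], siz := List.replicate E (), sizTmp := [] })
        .check { m with dig := [], cnt := List.replicate (N / 2 ^ (i + L)) ()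
                        cntTmp := [], siz := List.replicate E' (), sizTmp := [] }
        fun r' => r'.acc = r.acc := by
  induction L generalizing i E r with
  | zero =>
    refine ⟨E, hE, hE', Run.mono (n := 1) (.head ?_) (by simp) fun _ h => h⟩
    simp
    exact .refl rfl
  | succ L ih =>
    have hdiv : N / 2 ^ i / 2 = N / 2 ^ (i + 1) := by rw [Nat.div_div_eq_div_mul, pow_succ]
    -- Invariant: `siz` holds the power of two as long as that power is at most `N`. Afterwards it
    -- is frozen and its value is irrelevant.
    set E₁ := if N / 2 ^ (i + 1) = 0 then E else 2 * E with hE₁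
    have hne : N / 2 ^ (i + 1) ≠ 0 → N / 2 ^ i ≠ 0 := fun h h0 => h (by rw [← hdiv, h0])
    have hE₁' : N / 2 ^ (i + 1) ≠ 0 → E₁ = 2 ^ (i + 1) := fun h => by
      rw [hE₁, if_neg h, hE' (hne h), pow_succ, mul_comm]
    have hE₁N : E₁ ≤ N + 1 := by
      by_cases h : N / 2 ^ (i + 1) = 0
      · rw [hE₁, if_pos h]; exact hE
      · rw [hE₁' h]
        by_contra hlt
        exact h (Nat.div_eq_of_lt (by omega))
    have hstep := run_digit E (N / 2 ^ i) (List.replicate L ()) r m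
    rw [hdiv, ← hE₁] at hstep
    obtain ⟨r₁, hs₁, hr₁⟩ := hstep
    obtain ⟨E', hE'N, hE'2, r₂, hs₂, hr₂⟩ := ih (i + 1) E₁ hE₁N hE₁' r₁
    rw [add_right_comm, add_assoc] at hE'2
    refine ⟨E', hE'N, hE'2, r₂, ?_, hr₂.trans hr₁⟩
    rw [show i + (L + 1) = i + 1 + L by omega]
    refine (hs₁.trans hs₂).mono ?_
    have h₁ : N / 2 ^ i ≤ N := Nat.div_le_self _ _
    have h₂ : N / 2 ^ (i + 1) ≤ N := Nat.div_le_self _ _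
    have h₃ : (L + 1) * (5 * N + 9) = L * (5 * N + 9) + (5 * N + 9) := by ring
    omega

end Machine

end HardFunction

/-! ### Complete runs and the time bound. -/

namespace HardFunction

namespace Machine

theorem stepAux_popMany (n a : ℕ) (l l' : Label) (r : Reg) (m : Mem) :
    ∃ r' : Reg, r'.acc = r.acc ∧
      Turing.TM2.stepAux (popMany .cnt n (jump l) (jump l')) r
        { m with cnt := List.replicate a () }.stk =
      if n ≤ a then cfg l r' { m with cnt := List.replicate (a - n) () }
        else cfg l' r' { m with cnt := [] } := by
  induction n generalizing a r with
  | zero => exact ⟨r, rfl, by simp [cfg]⟩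
  | succ n ih =>
    cases a with
    | zero => exact ⟨{ r with ok := false }, rfl, by simp [cfg]⟩
    | succ a =>
      obtain ⟨r', h, hr'⟩ := ih a { r with ok := true }
      refine ⟨r', h, ?_⟩
      simp only [Nat.add_le_add_iff_right, Nat.add_sub_add_right]
      rw [← hr']
      simp [List.replicate_succ]

theorem run_check (a : ℕ) (r : Reg) (m : Mem) :
    (32 ≤ a → Run 1 (cfg .check r { m with cnt := List.replicate a () }) .init
      { m with cnt := List.replicate (a - 32) () } fun r' => r'.acc = r.acc) ∧
    (¬ 32 ≤ a → Run 1 (cfg .check r { m with cnt := List.replicate a () }) .parity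
      { m with cnt := [] } fun r' => r'.acc = r.acc) := by
  obtain ⟨r', h, hr'⟩ := stepAux_popMany 32 a .init .parity r m
  constructor
  · intro ha
    rw [if_pos ha] at hr'
    exact ⟨r', hr' ▸ Steps.single .check r _, h⟩
  · intro ha
    rw [if_neg ha] at hr'
    exact ⟨r', hr' ▸ Steps.single .check r _, h⟩

/-- The final configuration with output `b`. -/
def final (b : Bool) : Turing.TM2.Cfg Alphabet Label Reg :=
  ⟨none, Reg.init, { out := [b] : Mem }.stk⟩

/-- A halting configuration must have empty working stacks and initial registers. The three possible
leftovers are popped in parallel, so the longest determines the time. -/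
theorem run_clean (n : ℕ) (cnt siz : List Unit) (w : List (ZMod 5)) (h₁ : cnt.length ≤ n)
    (h₂ : siz.length ≤ n) (h₃ : w.length ≤ n) (r : Reg) :
    Steps (n + 1) (cfg .clean r { cnt := cnt, siz := siz, w := w })
      (final (decide (r.acc = 1))) := by
  induction n generalizing cnt siz w r with
  | zero =>
    obtain rfl := List.length_eq_zero_iff.1 (Nat.le_zero.1 h₁)
    obtain rfl := List.length_eq_zero_iff.1 (Nat.le_zero.1 h₂)
    obtain rfl := List.length_eq_zero_iff.1 (Nat.le_zero.1 h₃)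
    refine .head ?_
    simp
    exact .refl _ _
  | succ n ih =>
    refine .head ?_
    have key : ∀ r', r'.acc = r.acc → Steps (n + 1)
        (cfg .clean r' { cnt := cnt.tail, siz := siz.tail, w := w.tail })
        (final (decide (r.acc = 1))) := fun r' hr' => by
      rw [← hr']
      exact ih cnt.tail siz.tail w.tail (by simp; omega) (by simp; omega) (by simp; omega) r'
    cases cnt <;> cases siz <;> cases w <;> simp
    · exact .refl _ _
    all_goals exact key _ rfl

/-- The partial sums of the selector. -/
def partialSelector (e : ℕ) (x : List Bool) (i : ℕ) : List Slot :=
  List.ofFn fun j : Fin e => ∑ k ∈ (Finset.range i).filter (· % e = j), slotAt x k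

/-- Group `i` contributes only to the entry `i % e`, which is where the machine's cursor stands. -/
theorem partialSelector_succ {e : ℕ} (x : List Bool) (i : ℕ) (A B : List Slot)
    (s : Slot) (h : A ++ s :: B = partialSelector e x i) (hA : A.length = i % e) :
    A ++ (s + slotAt x i) :: B = partialSelector e x (i + 1) := by
  have hlen := congrArg List.length h
  simp only [partialSelector, List.length_append, List.length_cons, List.length_ofFn] at hlen
  refine List.ext_getElem (by simp [partialSelector, hlen]) fun j h₁ h₂ => ?_
  have hj : j < (A ++ s :: B).length := by simpa using h₁
  have hget : (A ++ s :: B)[j] =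
      ∑ k ∈ (Finset.range i).filter (· % e = j), slotAt x k := by
    simp only [h, partialSelector, List.getElem_ofFn]
  have hsum : (partialSelector e x (i + 1))[j] =
      (A ++ s :: B)[j] + if i % e = j then slotAt x i else 0 := by
    rw [hget]
    simp only [partialSelector, List.getElem_ofFn, Finset.sum_filter, Finset.sum_range_succ]
  rw [hsum]
  rcases lt_trichotomy j A.length with hlt | heq | hgt
  · rw [if_neg (by omega), List.getElem_append_left hlt, List.getElem_append_left hlt, add_zero]
  · rw [if_pos (by omega)]
    subst heq
    simp
  · rw [if_neg (by omega), List.getElem_append_right hgt.le, List.getElem_append_right hgt.le,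
      add_zero]
    obtain ⟨d, hd⟩ := Nat.exists_eq_add_of_lt hgt
    have hd' : j - A.length = d + 1 := by omega
    simp only [hd', List.getElem_cons_succ]

theorem drop_eq_bitAt_cons {x : List Bool} {p : ℕ} (hp : p < x.length) :
    x.drop p = bitAt x p :: x.drop (p + 1) := by
  rw [List.drop_eq_getElem_cons hp, bitAt, List.getD_eq_getElem _ _ hp]

theorem drop_eq_group {x : List Bool} {i : ℕ} (hi : i < x.length / 5) :
    x.drop (5 * i) = bitAt x (5 * i) :: bitAt x (5 * i + 1) :: bitAt x (5 * i + 2) ::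
      bitAt x (5 * i + 3) :: bitAt x (5 * i + 4) :: x.drop (5 * (i + 1)) := by
  rw [drop_eq_bitAt_cons (by omega), drop_eq_bitAt_cons (by omega), drop_eq_bitAt_cons (by omega),
    drop_eq_bitAt_cons (by omega), drop_eq_bitAt_cons (by omega)]
  rfl

theorem slotAt_eq_update (x : List Bool) (i : ℕ) (f : Fin 3 → ZMod 2) :
    slotAt x i = (toF2 (bitAt x (5 * i + 1)), Function.update (Function.update (Function.update f 0
      (toF2 (bitAt x (5 * i + 2)))) 1 (toF2 (bitAt x (5 * i + 3)))) 2
      (toF2 (bitAt x (5 * i + 4)))) := by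
  refine Prod.ext rfl (funext fun s => ?_)
  fin_cases s <;> simp [slotAt, Function.update]

theorem run_group (x : List Bool) (i : ℕ) (hi : i < x.length / 5) (zl zr : List Slot)
    (s : Slot) (ys : List Bool) (r : Reg) (m : Mem) :
    Run 1 (cfg .split r { m with xs := x.drop (5 * i), ys := ys, zl := zl, zr := s :: zr })
      .split { m with xs := x.drop (5 * (i + 1)), ys := bitAt x (5 * i) :: ys
                      zl := (s + slotAt x i) :: zl, zr := zr }
      fun r' => r'.acc = r.acc := by
  refine .head (n := 0) ?_
  rw [drop_eq_group hi, slotAt_eq_update x i r.slot.2]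
  simp
  exact .refl rfl

/-- The stacks `zl` and `zr` form a zipper with the cursor at `i % e`. When the cursor passes the
end, pouring `zl` back starts the next block. -/
theorem run_split_step {e : ℕ} (he : 0 < e) (x : List Bool) (i : ℕ) (hi : i < x.length / 5)
    (zl zr : List Slot) (h : zl.reverse ++ zr = partialSelector e x i) (hl : zl.length = i % e)
    (ys : List Bool) (r : Reg) (m : Mem) :
    ∃ zl' zr', zl'.reverse ++ zr' = partialSelector e x (i + 1) ∧ zl'.length = (i + 1) % e ∧
      Run (e + 3) (cfg .split r { m with xs := x.drop (5 * i), ys := ys, zl := zl, zr := zr })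
        .split { m with xs := x.drop (5 * (i + 1)), ys := bitAt x (5 * i) :: ys
                        zl := zl', zr := zr' }
        fun r' => r'.acc = r.acc := by
  have hlen := congrArg List.length h
  simp only [partialSelector, List.length_append, List.length_reverse, List.length_ofFn] at hlen
  have hmod := Nat.mod_lt i he
  obtain _ | ⟨s, zr⟩ := zr
  · simp at hlen; omega
  rw [List.length_cons] at hlen
  have hsel := partialSelector_succ x i zl.reverse zr s h (by simpa using hl)
  have hg := run_group x i hi zl zr s ys r m
  obtain _ | ⟨s', zr⟩ := zr
  · refine ⟨[], partialSelector e x (i + 1), rfl, ?_, ?_⟩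
    · have : i % e + 1 = e := by simp at hlen; omega
      rw [List.length_nil, ← Nat.mod_add_mod, this, Nat.mod_self]
    · refine Run.mono (n := 1 + (e + 2)) (hg.trans fun r₁ h₁ => .head ?_) (by omega) fun _ h => h
      simp
      have hp := run_pourSel .split ((s + slotAt x i) :: zl) [] { r₁ with ok := false }
        { m with xs := x.drop (5 * (i + 1)), ys := bitAt x (5 * i) :: ys }
      rw [List.reverse_cons, List.append_assoc, List.singleton_append, hsel] at hp
      exact hp.mono (by simp at hlen ⊢; omega) fun r₂ h₂ => h₂.1.trans h₁
  · refine ⟨(s + slotAt x i) :: zl, s' :: zr, ?_, ?_, hg.mono (by omega) fun _ h => h⟩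
    · rw [← hsel]; simp
    · rw [List.length_cons] at hlen ⊢
      rw [← Nat.mod_add_mod, Nat.mod_eq_of_lt (by omega), hl]

theorem run_split {e : ℕ} (he : 0 < e) (x : List Bool) (d i : ℕ) (hd : i + d = x.length / 5)
    (zl zr : List Slot) (h : zl.reverse ++ zr = partialSelector e x i) (hl : zl.length = i % e)
    (r : Reg) (m : Mem) :
    Run (d * (e + 3) + (e + 2))
      (cfg .split r { m with
        xs := x.drop (5 * i), ys := ((List.range i).map fun k => bitAt x (5 * k)).reverse
        zl := zl, zr := zr })
      .horner { m with xs := [], ys := (message x).reverse, zl := [], zr := selector e x }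
      fun r' => r'.acc = r.acc := by
  induction d generalizing i zl zr r with
  | zero =>
    rw [add_zero] at hd
    have hlen := congrArg List.length h
    simp only [partialSelector, List.length_append, List.length_reverse, List.length_ofFn] at hlen
    have hmod := Nat.mod_lt i he
    obtain _ | ⟨s, zr⟩ := zr
    · simp at hlen; omega
    have hshort : (x.drop (5 * i)).length < 5 := by rw [List.length_drop, hd]; omega
    have hsel : zl.reverse ++ s :: zr = selector e x := by rw [h, hd]; rfl
    rw [← hsel, message, ← hd]
    have key : ∀ r' : Reg, r'.acc = r.acc → Run (e + 1) (cfg (.pourSel .horner) r' { m with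
        xs := [], ys := ((List.range i).map fun k => bitAt x (5 * k)).reverse
        zl := zl, zr := s :: zr }) .horner { m with
        xs := [], ys := ((List.range i).map fun k => bitAt x (5 * k)).reverse
        zl := [], zr := zl.reverse ++ s :: zr } fun r' => r'.acc = r.acc := fun r' hr' =>
      (run_pourSel .horner zl (s :: zr) r' { m with
        xs := [], ys := ((List.range i).map fun k => bitAt x (5 * k)).reverse }).mono (by omega)
        fun r₁ h₁ => h₁.1.trans hr'
    refine Run.mono (n := e + 1 + 1) (.head ?_) (by omega) fun _ h => h
    -- Fewer than five bits remain. The attempt to read a group consumes and discards them, and its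
    -- failure ends the loop.
    generalize x.drop (5 * i) = l at hshort
    match l, hshort with
    | [], _ => simp; exact key _ rfl
    | [_], _ => simp; exact key _ rfl
    | [_, _], _ => simp; exact key _ rfl
    | [_, _, _], _ => simp; exact key _ rfl
    | [_, _, _, _], _ => simp; exact key _ rfl
    | _ :: _ :: _ :: _ :: _ :: _, h => simp at h; omega
  | succ d ih =>
    obtain ⟨zl', zr', h', hl', hs⟩ := run_split_step he x i (by omega) zl zr h hl
      ((List.range i).map fun k => bitAt x (5 * k)).reverse r m
    refine Run.mono (n := (e + 3) + (d * (e + 3) + (e + 2))) (hs.trans fun r₁ h₁ => ?_)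
      (by rw [Nat.succ_mul]; omega) fun _ h => h
    have := ih (i + 1) (by omega) zl' zr' h' hl' r₁
    rw [List.range_succ, List.map_append, List.reverse_append] at this
    exact this.mono le_rfl fun _ h => h.trans h₁

theorem run_code {e : ℕ} (he : 0 < e) (x : List Bool) (c : ℕ) (r : Reg) :
    Run (12 * (x.length + 1) * (e + 2) ^ 2)
      (cfg .init r { xs := x, cnt := List.replicate c (), siz := List.replicate e () })
      .clean { cnt := List.replicate c (), w := List.replicate e 0 }
      fun r' => r'.acc = r.acc + codeBit (message x).reverse (selector e x) := by
  have hsl : (selector e x).length = e := by simp [selector]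
  have hi := run_init e 0 r { xs := x, cnt := List.replicate c () }
  have hrep : List.replicate e (0 : Slot) = partialSelector e x 0 := by
    simp [partialSelector]
  simp only [List.replicate_zero, add_zero] at hi
  have hs := run_split he x (x.length / 5) 0 (zero_add _) [] (List.replicate e 0) hrep
    (by simp)
  have hho := run_horner (message x).reverse (selector e x) (List.replicate e 0) (by simp [hsl])
    (by rw [← List.length_pos_iff, hsl]; exact he)
  have hout := run_output (horner e ((selector e x).map Prod.fst) (message x).reverse)
    (selector e x) (by rw [length_horner, hsl])
  simp only [List.length_replicate] at hho
  simp only [mul_zero, List.drop_zero, List.range_zero, List.map_nil, List.reverse_nil] at hs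
  refine Run.mono (hi.trans fun r₁ h₁ => (hs r₁ { cnt := List.replicate c ()
                                                  v := List.replicate e 0
                                                  w := List.replicate e 0 }).trans fun r₂ h₂ =>
    (hho r₂ { cnt := List.replicate c () }).trans fun r₃ h₃ =>
      (hout r₃ { cnt := List.replicate c (), w := List.replicate e 0 }).mono le_rfl
        fun r₄ h₄ => (?_ : r₄.acc = r.acc + codeBit (message x).reverse (selector e x)))
    ?_ fun _ h => h
  · rw [h₄, h₃, h₂, h₁, codeBit, hsl]
  · have hM : (message x).reverse.length ≤ x.length := by
      simp [message, Nat.div_le_self]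
    have hM' : x.length / 5 ≤ x.length := Nat.div_le_self _ _
    rw [hsl, length_horner]
    have hq : e + 3 ≤ (e + 2) ^ 2 := by nlinarith
    have h₁ := Nat.mul_le_mul hM' hq
    have h₂ := Nat.mul_le_mul_right (2 * (e + 2) ^ 2) hM
    nlinarith

/-- Reading onto a stack reverses the input, which is why `hardFn` works with `x.reverse`. The
parity does not depend on the order. -/
theorem run_hardFn (k : ℕ) (x : List Bool) :
    Steps (100 * ((Computability.encodeNat k).length + x.length + 1) ^ 3)
      (cfg .read Reg.init { inp := (Computability.encodeNat k).map Sum.inl ++ x.map Sum.inr })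
      (final (hardFn k x)) := by
  have hr : (x.reverse.map toF2).sum = (x.map toF2).sum := by
    rw [List.map_reverse, List.sum_reverse]
  rw [hardFn]
  generalize Computability.encodeNat k = D
  set L := D.length with hL
  set n := x.length with hn
  obtain ⟨r₁, hs₁, hr₁⟩ := run_read_digits D (x.map Sum.inr) 0 Reg.init {}
  obtain ⟨r₂, hs₂, hr₂⟩ := run_read_bits x [] 0 r₁ { dig := List.replicate L () }
  obtain ⟨E, hE, hE', r₃, hs₃, hr₃⟩ := run_digits n L 0 1 (by omega) (fun _ => rfl) r₂
    { xs := x.reverse }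
  simp only [List.replicate_zero, add_zero, pow_zero, Nat.div_one, zero_add, List.append_nil,
    ← hL, ← hn] at hs₁ hs₂ hs₃ hE'
  have hs := (hs₁.trans hs₂).trans hs₃
  have hacc : r₃.acc = 0 := by rw [hr₃, hr₂, hr₁]; rfl
  have hcond : 32 * 2 ^ L ≤ n ↔ 32 ≤ n / 2 ^ L := (Nat.le_div_iff_mul_le (by positivity)).symm
  have hq : L + n + (L * (5 * n + 9) + 1) ≤ 20 * (L + n + 1) ^ 3 := by
    have h₁ : (L + n + 1) ^ 2 ≤ (L + n + 1) ^ 3 := Nat.pow_le_pow_right (by omega) (by omega)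
    nlinarith
  have hq' : n + 1 ≤ (L + n + 1) ^ 3 :=
    (by omega : n + 1 ≤ L + n + 1).trans (Nat.le_self_pow (by norm_num) _)
  obtain ⟨hc₁, hc₂⟩ := run_check (n / 2 ^ L) r₃ { xs := x.reverse, siz := List.replicate E () }
  by_cases h : 32 ≤ n / 2 ^ L
  -- The quotient is nonzero, so `siz` holds exactly `2 ^ L`.
  · obtain rfl := hE' (by omega)
    have hen : 2 ^ L ≤ n := by have := hcond.2 h; omega
    obtain ⟨r₄, hs₄, hr₄⟩ := hc₁ h
    obtain ⟨r₅, hs₅, hr₅⟩ := run_code (e := 2 ^ L) (by positivity) x.reverse (n / 2 ^ L - 32) r₄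
    have hs₆ := run_clean n (List.replicate (n / 2 ^ L - 32) ()) [] (List.replicate (2 ^ L) 0)
      (by have := Nat.div_le_self n (2 ^ L); simp; omega) (by simp) (by simpa using hen) r₅
    rw [if_pos (hcond.2 h)]
    rw [hr₅, hr₄, hacc, zero_add] at hs₆
    refine (((hs.trans hs₄).trans hs₅).trans hs₆).mono ?_
    rw [List.length_reverse, ← hn]
    have h₂ : 12 * (n + 1) * (2 ^ L + 2) ^ 2 ≤ 48 * (L + n + 1) ^ 3 := by
      calc 12 * (n + 1) * (2 ^ L + 2) ^ 2
          ≤ 12 * (L + n + 1) * (2 * (L + n + 1)) ^ 2 := by gcongr <;> omega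
        _ = 48 * (L + n + 1) ^ 3 := by ring
    omega
  · obtain ⟨r₄, hs₄, hr₄⟩ := hc₂ h
    obtain ⟨r₅, hs₅, hr₅⟩ := run_parity x.reverse r₄ { siz := List.replicate E () }
    have hs₆ := run_clean (n + 1) [] (List.replicate E ()) [] (by simp) (by simpa using hE)
      (by simp) r₅
    rw [if_neg (fun h' => h (hcond.1 h'))]
    rw [hr₅, hr₄, hacc, zero_add, hr] at hs₆
    refine (((hs.trans hs₄).trans hs₅).trans hs₆).mono ?_
    rw [List.length_reverse, ← hn]
    omega

/-- The machine with its input and output stacks. -/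
noncomputable def finTM2 : Turing.FinTM2 where
  K := Stack
  k₀ := .inp
  k₁ := .out
  Γ := Alphabet
  Λ := Label
  main := .read
  σ := Reg
  initialState := Reg.init
  Γk₀Fin := inferInstanceAs (Fintype (Bool ⊕ Bool))
  m := program

theorem initList_finTM2 (l : List (Bool ⊕ Bool)) :
    Turing.initList finTM2 l = cfg .read Reg.init { inp := l } := by
  refine congrArg (Turing.TM2.Cfg.mk _ _) (funext fun k => ?_)
  cases k <;> rfl

theorem haltList_finTM2 (b : Bool) : Turing.haltList finTM2 [b] = final b := by
  refine congrArg (Turing.TM2.Cfg.mk _ _) (funext fun k => ?_)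
  cases k <;> rfl

end Machine

theorem uniformlyPolyTime_hardFn : UniformlyPolyTime hardFn := by
  refine ⟨{
    tm := Machine.finTM2
    inputAlphabet := Equiv.refl _
    outputAlphabet := Equiv.refl _
    time := 100 * (Polynomial.X + 1) ^ 3
    outputsFun := fun p => Classical.choice ?_ }⟩
  obtain ⟨s, hs, h⟩ := Machine.run_hardFn p.1 p.2
  refine ⟨⟨⟨s, ?_⟩, ?_⟩⟩
  · have hinit : Turing.initList Machine.finTM2 (List.map (Equiv.refl (Bool ⊕ Bool)).invFun
        ((Computability.encodeNat p.1).map Sum.inl ++ p.2.map Sum.inr)) =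
        Machine.cfg .read Machine.Reg.init
          { inp := (Computability.encodeNat p.1).map Sum.inl ++ p.2.map Sum.inr } :=
      (congrArg (Turing.initList Machine.finTM2) (List.map_id _)).trans
        (Machine.initList_finTM2 _)
    exact (congrArg (fun c => (flip bind (Turing.TM2.step Machine.program))^[s] (some c))
      hinit).trans (h.trans (congrArg some (Machine.haltList_finTM2 _).symm))
  · refine hs.trans (le_of_eq ?_)
    simp [Computability.encodingProd, Computability.encodingNatBool, Computability.encodingList]

end HardFunction

theorem theorem1p1 :
    ∃ c d γ : ℝ, 1 ≤ c ∧ 1 ≤ d ∧ 0 < γ ∧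
      ∃ f : ℕ → List Bool → Bool, UniformlyPolyTime f ∧
        -- average-case hardness
        (∀ n k : ℕ, 2 ≤ n → c * Real.logb 2 n ≤ k →
          ∀ C : ComparatorCircuit n,
            ((C.numWires : ℝ) ≤ (n : ℝ) ^ (3 / 2 : ℝ) / (d * k * √(Real.logb 2 n)) ∨
              (C.numGates : ℝ) ≤ (n : ℝ) ^ (3 / 2 : ℝ) / (d * k * √(Real.logb 2 n))) →
            C.agreement (onLength (f k) n) ≤ 1 / 2 + (2 : ℝ) ^ (-(γ * k))) ∧
        -- the case `k = O(log n)`: worst-case hardness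
        (∀ K : ℝ, ∃ δ : ℝ, 0 < δ ∧ ∀ n k : ℕ, 2 ≤ n →
          c * Real.logb 2 n ≤ k → (k : ℝ) ≤ K * Real.logb 2 n →
          ∀ C : ComparatorCircuit n, (∀ x, C.eval x = onLength (f k) n x) →
            δ * ((n : ℝ) / Real.logb 2 n) ^ (3 / 2 : ℝ) ≤ C.numWires ∧
              δ * ((n : ℝ) / Real.logb 2 n) ^ (3 / 2 : ℝ) ≤ C.numGates) :=
  -- `16` makes `log n` small against `e`, `1024` covers the factor `12 * 80` in the estimate of
  -- `ℓ`, and `1 / 8` is the exponent of `ε = 2 ^ (-e / 8)` with `e ≥ k`.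
  ⟨16, 1024, 1 / 8, by norm_num, by norm_num, by norm_num, HardFunction.hardFn,
    HardFunction.uniformlyPolyTime_hardFn,
    fun _ _ hn hk C hC => HardFunction.agreement_hardFn_le hn hk C hC,
    fun K => ⟨1 / (1024 * (|K| + 1)), by positivity, fun _ _ hn hk hK C hC =>
      HardFunction.size_le_of_computes hn hk hK C hC⟩⟩
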